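/- Let $n\ge 1$ and let $\mathcal Y$ be a complex Hilbert space. For $j\ge1$ and a Hilbert space $\mathcal U$ let $\mathcal A_j(\mathcal U)$ be the Hilbert space of power series $f(z)=\sum_{k\ge0}f_kz^k$, $f_k\in\mathcal U$, on the unit disk $\mathbb D$ with $\|f\|^2=\sum_{k\ge 0}\binom{k+j-1}{k}^{-1}\|f_k\|^2<\infty$, that is, the reproducing kernel Hilbert space with kernel $(1-z\bar\zeta)^{-j}I_{\mathcal U}$. Let $S_n\colon f(z)\mapsto zf(z)$ on $\mathcal A_n(\mathcal Y)$, and let $\mathcal M$ be a closed subspace of $\mathcal A_n(\mathcal Y)$ with $S_n\mathcal M\subset\mathcal M$. Then there are Hilbert spaces $\mathcal U_1,\dots,\mathcal U_n$ and holomorphic functions $F_j\colon\mathbb D\to\mathcal L(\mathcal U_j,\mathcal Y)$, $j=1,\dots,n$, with the following properties. (1) With $F=[F_1\ \cdots\ F_n]$, the formula $M_F(h_1,\dots,h_n)=\sum_{j=1}^nF_jh_j$ defines a bounded operator $M_F\colon\bigoplus_{j=1}^n\mathcal A_j(\mathcal U_j)\to\mathcal A_n(\mathcal Y)$, which is a partial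 isometry (isometric on $(\ker M_F)^\perp$), and $$\mathcal M=M_F\Big(\bigoplus_{j=1}^n\mathcal A_j(\mathcal U_j)\Big).$$ (2) The reproducing kernel of $\mathcal M$ (with the norm of $\mathcal A_n(\mathcal Y)$) is $$k_{\mathcal M}(z,\zeta)=\sum_{j=1}^n\frac{F_j(z)F_j(\zeta)^*}{(1-z\bar\zeta)^j}\qquad(z,\zeta\in\mathbb D).$$ (3) The $F_j$ have the following realization. Let $\mathcal X=\mathcal M^\perp$, $A=S_n^*|_{\mathcal X}\in\mathcal L(\mathcal X)$, $C\colon\mathcal X\to\mathcal Y$, $Cf=f(0)$. For $0\le m\le n$ the series $G_m=\sum_{k\ge0}\binom{k+m-1}{k}A^{*k}C^*CA^k$ (with $G_0=C^*C$) converges strongly to a bounded operator on $\mathcal X$. Put $Q_1=C\colon\mathcal X\to\mathcal Z_1:=\mathcal Y$ and $Q_m=G_{m-1}^{1/2}\colon\mathcal X\to\mathcal Z_m:=\mathcal X$ for $2\le m\le n$. For each $m=1,\dots,n$ there is a unitary operator $$\begin{bmatrix}A_m&B_m\\C_m&D_m\end{bmatrix}\colon\mathcal X\oplus\mathcal U_{n+1-m}\to\mathcal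 X\oplus\mathcal Z_m\quad\text{with}\quad A_mG_m^{1/2}=G_m^{1/2}A,\qquad C_mG_m^{1/2}=Q_m,$$ and, with $\Psi_m(z)=D_m+zC_m(I-zA_m)^{-1}B_m$, $$F_n(z)=\Psi_1(z),\qquad F_\ell(z)=N_{n-\ell}(z)\,\Psi_{n+1-\ell}(z)\quad(1\le\ell\le n-1),\qquad z\in\mathbb D,$$ where $N_k(z)\in\mathcal L(\mathcal X,\mathcal Y)$ satisfies $N_k(z)G_k^{1/2}=C(I-zA)^{-k}$, that is, $N_k(z)=C(I-zA)^{-k}G_k^{-1/2}$ when $G_k$ is boundedly invertible. -/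

import Mathlib

open scoped InnerProductSpace ComplexConjugate

universe u

noncomputable section

/-- The weight `μ_{n,j} = 1 / binom(j+n-1, j)`. -/
def bergmanWeight (n j : ℕ) : ℝ := ((j + n - 1).choose j : ℝ)⁻¹

theorem bergmanWeight_pos (n j : ℕ) [NeZero n] : 0 < bergmanWeight n j := by
  have hn : 0 < n := Nat.pos_of_ne_zero (NeZero.ne n)
  have : 0 < (j + n - 1).choose j := Nat.choose_pos (by omega)
  unfold bergmanWeight
  positivity

theorem bergmanWeight_zero (n : ℕ) : bergmanWeight n 0 = 1 := by
  simp [bergmanWeight]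

theorem bergmanWeight_succ_le (n j : ℕ) [NeZero n] :
    bergmanWeight n (j + 1) ≤ bergmanWeight n j := by
  have hn : 0 < n := Nat.pos_of_ne_zero (NeZero.ne n)
  have h0 : 0 < (j + n - 1).choose j := Nat.choose_pos (by omega)
  have h1 : (j + n - 1).choose j ≤ (j + 1 + n - 1).choose (j + 1) := by
    obtain ⟨m, rfl⟩ : ∃ m, n = m + 1 := ⟨n - 1, by omega⟩
    have e1 : j + (m + 1) - 1 = j + m := by omega
    have e2 : j + 1 + (m + 1) - 1 = j + m + 1 := by omega
    rw [e1, e2, Nat.choose_succ_succ]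
    exact Nat.le_add_right _ _
  unfold bergmanWeight
  gcongr

theorem bergmanWeight_le_one (n j : ℕ) [NeZero n] : bergmanWeight n j ≤ 1 := by
  induction j with
  | zero => exact (bergmanWeight_zero n).le
  | succ j ih => exact (bergmanWeight_succ_le n j).trans ih

theorem summable_geometric_div_bergmanWeight (n : ℕ) [NeZero n] {r : ℝ} (h0 : 0 ≤ r)
    (h1 : r < 1) : Summable fun j => r ^ j * (bergmanWeight n j)⁻¹ := by
  obtain ⟨m, rfl⟩ : ∃ m, n = m + 1 :=
    ⟨n - 1, by have := NeZero.ne n; omega⟩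
  have := summable_choose_mul_geometric_of_norm_lt_one (R := ℝ) m (r := r)
    (by rwa [Real.norm_of_nonneg h0])
  refine this.congr fun j => ?_
  have e1 : j + (m + 1) - 1 = j + m := by omega
  rw [bergmanWeight, e1, inv_inv, mul_comm, Nat.choose_symm_add]

section Space

variable (n : ℕ) (Y : Type u) [NormedAddCommGroup Y] [InnerProductSpace ℂ Y]

theorem memℓp_bergman_iff [NeZero n] (a : ℕ → Y) :
    Memℓp (fun j => ((Real.sqrt (bergmanWeight n j) : ℝ) : ℂ) • a j) 2 ↔
      Summable fun j => bergmanWeight n j * ‖a j‖ ^ 2 := by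
  rw [memℓp_gen_iff (by norm_num)]
  refine summable_congr fun j => ?_
  have h := (bergmanWeight_pos n j).le
  rw [norm_smul, Complex.norm_real, Real.norm_of_nonneg (Real.sqrt_nonneg _)]
  simp only [ENNReal.toReal_ofNat, Real.rpow_ofNat]
  rw [mul_pow, Real.sq_sqrt h]

/-- Coefficient sequences `(f_j)` in `Y` with `∑ μ_{n,j} ‖f_j‖² < ∞`. -/
def bergmanSubmodule [NeZero n] : Submodule ℂ (ℕ → Y) where
  carrier := {a | Summable fun j => bergmanWeight n j * ‖a j‖ ^ 2}
  zero_mem' := by simp [summable_zero]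
  add_mem' := by
    intro a b ha hb
    have ha' := (memℓp_bergman_iff n Y a).2 ha
    have hb' := (memℓp_bergman_iff n Y b).2 hb
    refine (memℓp_bergman_iff n Y (a + b)).1 ?_
    have := ha'.add hb'
    convert this using 1
    funext j
    simp [smul_add]
  smul_mem' := by
    intro c a ha
    have : Summable fun j => ‖c‖ ^ 2 * (bergmanWeight n j * ‖a j‖ ^ 2) := ha.mul_left _
    refine this.congr fun j => ?_
    have hn : ‖(c • a) j‖ = ‖c‖ * ‖a j‖ := norm_smul c (a j)
    rw [hn]
    ring

/-- The weighted Bergman space `𝒜_n(Y)`: power series `f(z) = ∑ f_j z^j` with coefficients in `Y`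
and `‖f‖² = ∑ μ_{n,j} ‖f_j‖² < ∞`; an element is given by its Taylor coefficients, and its values
on the unit disk are provided by the `RKHS` instance below. -/
def Bergman [NeZero n] : Type u := bergmanSubmodule n Y

end Space

namespace Bergman

section Hilbert

variable {n : ℕ} [NeZero n] {Y : Type u} [NormedAddCommGroup Y] [InnerProductSpace ℂ Y]

instance : AddCommGroup (Bergman n Y) := inferInstanceAs (AddCommGroup (bergmanSubmodule n Y))

instance : Module ℂ (Bergman n Y) := inferInstanceAs (Module ℂ (bergmanSubmodule n Y))

/-- The Taylor coefficients. -/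
def coeff (f : Bergman n Y) (j : ℕ) : Y := f.1 j

theorem summable_coeff (f : Bergman n Y) :
    Summable fun j => bergmanWeight n j * ‖f.coeff j‖ ^ 2 := f.2

/-- The element with prescribed Taylor coefficients. -/
def ofCoeff (a : ℕ → Y) (ha : Summable fun j => bergmanWeight n j * ‖a j‖ ^ 2) : Bergman n Y :=
  ⟨a, ha⟩

@[simp] theorem coeff_ofCoeff (a : ℕ → Y)
    (ha : Summable fun j => bergmanWeight n j * ‖a j‖ ^ 2) (j : ℕ) :
    (ofCoeff a ha).coeff j = a j := rfl

theorem coeff_ext {f g : Bergman n Y} (h : ∀ j, f.coeff j = g.coeff j) : f = g :=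
  Subtype.ext (funext h)

@[simp] theorem coeff_add (f g : Bergman n Y) (j : ℕ) :
    (f + g).coeff j = f.coeff j + g.coeff j := rfl

@[simp] theorem coeff_smul (c : ℂ) (f : Bergman n Y) (j : ℕ) :
    (c • f).coeff j = c • f.coeff j := rfl

@[simp] theorem coeff_zero (j : ℕ) : (0 : Bergman n Y).coeff j = 0 := rfl

/-- Rescaling of coefficients, `(f_j) ↦ (√μ_{n,j} f_j)`, onto `ℓ²(Y)`. -/
def toEll2 : Bergman n Y →ₗ[ℂ] lp (fun _ : ℕ => Y) 2 where
  toFun f := ⟨fun j => ((Real.sqrt (bergmanWeight n j) : ℝ) : ℂ) • f.coeff j,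
    (memℓp_bergman_iff n Y _).2 f.summable_coeff⟩
  map_add' f g := by
    ext j
    exact smul_add _ _ _
  map_smul' c f := by
    ext j
    exact smul_comm _ _ _

theorem toEll2_apply (f : Bergman n Y) (j : ℕ) :
    toEll2 f j = ((Real.sqrt (bergmanWeight n j) : ℝ) : ℂ) • f.coeff j := rfl

theorem sqrt_weight_ne_zero (n j : ℕ) [NeZero n] :
    ((Real.sqrt (bergmanWeight n j) : ℝ) : ℂ) ≠ 0 :=
  Complex.ofReal_ne_zero.2 (Real.sqrt_pos.2 (bergmanWeight_pos n j)).ne'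

theorem toEll2_injective : Function.Injective (toEll2 : Bergman n Y →ₗ[ℂ] _) := by
  intro f g h
  refine coeff_ext fun j => ?_
  have hj : toEll2 f j = toEll2 g j := by rw [h]
  rw [toEll2_apply, toEll2_apply] at hj
  exact smul_right_injective Y (sqrt_weight_ne_zero n j) hj

theorem toEll2_surjective : Function.Surjective (toEll2 : Bergman n Y →ₗ[ℂ] _) := by
  intro g
  have key : (fun j => ((Real.sqrt (bergmanWeight n j) : ℝ) : ℂ) •
      (((Real.sqrt (bergmanWeight n j) : ℝ) : ℂ)⁻¹ • g j)) = fun j => g j := by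
    funext j
    rw [smul_inv_smul₀ (sqrt_weight_ne_zero n j)]
  refine ⟨ofCoeff (fun j => ((Real.sqrt (bergmanWeight n j) : ℝ) : ℂ)⁻¹ • g j)
    ((memℓp_bergman_iff n Y _).1 (by rw [key]; exact g.2)), ?_⟩
  ext j
  rw [toEll2_apply, coeff_ofCoeff, smul_inv_smul₀ (sqrt_weight_ne_zero n j)]

instance : NormedAddCommGroup (Bergman n Y) :=
  NormedAddCommGroup.induced (Bergman n Y) (lp (fun _ : ℕ => Y) 2) toEll2 toEll2_injective

theorem norm_toEll2 (f : Bergman n Y) : ‖toEll2 f‖ = ‖f‖ := rfl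

theorem inner_toEll2 (f g : Bergman n Y) : ⟪toEll2 f, toEll2 g⟫_ℂ =
    ∑' j, (bergmanWeight n j : ℂ) * ⟪f.coeff j, g.coeff j⟫_ℂ := by
  rw [lp.inner_eq_tsum]
  refine tsum_congr fun j => ?_
  rw [toEll2_apply, toEll2_apply, inner_smul_left, inner_smul_right, Complex.conj_ofReal,
    ← mul_assoc, ← Complex.ofReal_mul, Real.mul_self_sqrt (bergmanWeight_pos n j).le]

/-- The inner product is `⟪f, g⟫ = ∑ μ_{n,j} ⟪f_j, g_j⟫`. -/
instance : InnerProductSpace ℂ (Bergman n Y) where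
  norm_smul_le c f := by
    rw [← norm_toEll2, ← norm_toEll2, map_smul]
    exact norm_smul_le _ _
  inner f g := ∑' j, (bergmanWeight n j : ℂ) * ⟪f.coeff j, g.coeff j⟫_ℂ
  norm_sq_eq_re_inner f := by
    rw [← inner_toEll2, ← norm_toEll2]
    exact InnerProductSpace.norm_sq_eq_re_inner _
  conj_inner_symm f g := by
    rw [← inner_toEll2, ← inner_toEll2]
    exact inner_conj_symm _ _
  add_left f g h := by
    rw [← inner_toEll2, ← inner_toEll2, ← inner_toEll2, map_add]
    exact inner_add_left _ _ _
  smul_left f g c := by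
    rw [← inner_toEll2, ← inner_toEll2, map_smul]
    exact inner_smul_left _ _ _

theorem inner_def (f g : Bergman n Y) :
    ⟪f, g⟫_ℂ = ∑' j, (bergmanWeight n j : ℂ) * ⟪f.coeff j, g.coeff j⟫_ℂ := rfl

theorem norm_sq_eq (f : Bergman n Y) : ‖f‖ ^ 2 = ∑' j, bergmanWeight n j * ‖f.coeff j‖ ^ 2 := by
  have h : ((‖f‖ ^ 2 : ℝ) : ℂ) = ((∑' j, bergmanWeight n j * ‖f.coeff j‖ ^ 2 : ℝ) : ℂ) := by
    have := inner_self_eq_norm_sq_to_K (𝕜 := ℂ) f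
    rw [inner_def] at this
    push_cast
    refine Eq.trans this.symm (tsum_congr fun j => ?_)
    rw [inner_self_eq_norm_sq_to_K]
    simp
  exact_mod_cast h

theorem norm_coeff_le (f : Bergman n Y) (j : ℕ) :
    ‖f.coeff j‖ ≤ (bergmanWeight n j)⁻¹ * ‖f‖ := by
  have hw := bergmanWeight_pos n j
  have h1 : bergmanWeight n j * ‖f.coeff j‖ ^ 2 ≤ ‖f‖ ^ 2 := by
    rw [norm_sq_eq]
    exact f.summable_coeff.le_tsum j fun i _ =>
      mul_nonneg (bergmanWeight_pos n i).le (sq_nonneg _)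
  rw [inv_mul_eq_div, le_div_iff₀ hw]
  refine le_of_sq_le_sq ?_ (norm_nonneg _)
  calc (‖f.coeff j‖ * bergmanWeight n j) ^ 2
      = bergmanWeight n j * (bergmanWeight n j * ‖f.coeff j‖ ^ 2) := by ring
    _ ≤ 1 * (bergmanWeight n j * ‖f.coeff j‖ ^ 2) :=
        mul_le_mul_of_nonneg_right (bergmanWeight_le_one n j) (by positivity)
    _ ≤ ‖f‖ ^ 2 := by rw [one_mul]; exact h1

instance [CompleteSpace Y] : CompleteSpace (Bergman n Y) := by
  have hi : Isometry (toEll2 : Bergman n Y →ₗ[ℂ] lp (fun _ : ℕ => Y) 2) :=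
    AddMonoidHomClass.isometry_of_norm _ norm_toEll2
  rw [completeSpace_iff_isComplete_range hi.isUniformInducing, toEll2_surjective.range_eq]
  exact isComplete_univ

end Hilbert

section Functions

variable {n : ℕ} [NeZero n] {Y : Type u} [NormedAddCommGroup Y] [InnerProductSpace ℂ Y]

theorem norm_pow_smul_coeff_le (z : ℂ) (f : Bergman n Y) (j : ℕ) :
    ‖z ^ j • f.coeff j‖ ≤ ‖z‖ ^ j * (bergmanWeight n j)⁻¹ * ‖f‖ := by
  rw [norm_smul, norm_pow, mul_assoc]
  exact mul_le_mul_of_nonneg_left (norm_coeff_le f j) (by positivity)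

theorem summable_norm_pow_smul_coeff {z : ℂ} (hz : ‖z‖ < 1) (f : Bergman n Y) :
    Summable fun j => ‖z ^ j • f.coeff j‖ :=
  Summable.of_nonneg_of_le (fun _ => norm_nonneg _) (norm_pow_smul_coeff_le z f)
    ((summable_geometric_div_bergmanWeight n (norm_nonneg z) hz).mul_right _)

variable [CompleteSpace Y]

theorem hasSum_pow_smul_coeff {z : ℂ} (hz : ‖z‖ < 1) (f : Bergman n Y) :
    HasSum (fun j => z ^ j • f.coeff j) (∑' j, z ^ j • f.coeff j) :=
  (summable_norm_pow_smul_coeff hz f).of_norm.hasSum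

/-- Point evaluation `f ↦ f(z) = ∑ f_j z^j` at a point `z` of the open unit disk. -/
def eval (z : Metric.ball (0 : ℂ) 1) : Bergman n Y →L[ℂ] Y :=
  LinearMap.mkContinuous
    { toFun := fun f => ∑' j, (z : ℂ) ^ j • f.coeff j
      map_add' := fun f g => by
        have hz : ‖(z : ℂ)‖ < 1 := mem_ball_zero_iff.1 z.2
        rw [← (hasSum_pow_smul_coeff hz f).summable.tsum_add
          (hasSum_pow_smul_coeff hz g).summable]
        exact tsum_congr fun j => smul_add _ _ _
      map_smul' := fun c f => by
        have hz : ‖(z : ℂ)‖ < 1 := mem_ball_zero_iff.1 z.2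
        rw [RingHom.id_apply, ← (hasSum_pow_smul_coeff hz f).summable.tsum_const_smul c]
        exact tsum_congr fun j => smul_comm _ _ _ }
    (∑' j, ‖(z : ℂ)‖ ^ j * (bergmanWeight n j)⁻¹)
    (fun f => by
      have hz : ‖(z : ℂ)‖ < 1 := mem_ball_zero_iff.1 z.2
      have hs := summable_geometric_div_bergmanWeight n (norm_nonneg (z : ℂ)) hz
      rw [← tsum_mul_right]
      exact tsum_of_norm_bounded (hs.mul_right ‖f‖).hasSum (norm_pow_smul_coeff_le _ f))

theorem eval_apply (z : Metric.ball (0 : ℂ) 1) (f : Bergman n Y) :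
    eval z f = ∑' j, (z : ℂ) ^ j • f.coeff j := rfl

theorem coeff_eq_zero_of_eval_eq_zero (f : Bergman n Y)
    (h : ∀ z : Metric.ball (0 : ℂ) 1, eval z f = 0) (j : ℕ) : f.coeff j = 0 := by
  let p : FormalMultilinearSeries ℂ ℂ Y :=
    fun k => ContinuousMultilinearMap.mkPiRing ℂ (Fin k) (f.coeff k)
  have hp : ∀ k, p.coeff k = f.coeff k := fun k => by
    simp [p, FormalMultilinearSeries.coeff]
  have hps : HasFPowerSeriesAt (fun _ : ℂ => (0 : Y)) p 0 := by
    rw [hasFPowerSeriesAt_iff]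
    filter_upwards [Metric.ball_mem_nhds (0 : ℂ) one_pos] with z hz
    have h1 := hasSum_pow_smul_coeff (mem_ball_zero_iff.1 hz) f
    rw [← eval_apply ⟨z, hz⟩ f, h ⟨z, hz⟩] at h1
    simpa [hp] using h1
  have h0 : p = 0 := hps.eq_zero
  rw [← hp j, h0]
  rfl

/-- `𝒜_n(Y)` as a reproducing kernel Hilbert space of `Y`-valued functions on the open unit disk. -/
instance : RKHS ℂ (Bergman n Y) (Metric.ball (0 : ℂ) 1) Y where
  coeCLM := ContinuousLinearMap.pi fun z => eval z
  coeCLM_injective := by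
    intro f g h
    have hfg : ∀ j, (f - g).coeff j = 0 := coeff_eq_zero_of_eval_eq_zero (f - g) fun z => by
      rw [map_sub, sub_eq_zero]
      exact congrFun h z
    exact sub_eq_zero.1 (coeff_ext hfg)

theorem apply_eq (f : Bergman n Y) (z : Metric.ball (0 : ℂ) 1) :
    f z = ∑' j, (z : ℂ) ^ j • f.coeff j := rfl

/-- The reproducing kernel of `𝒜_n(Y)` is `(1 - z ζ̄)^{-n} I_Y`. -/
theorem kernel_eq (z ζ : Metric.ball (0 : ℂ) 1) :
    RKHS.kernel (Bergman n Y) z ζ =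
      ((1 - (z : ℂ) * conj (ζ : ℂ)) ^ n)⁻¹ • ContinuousLinearMap.id ℂ Y := by
  obtain ⟨m, rfl⟩ : ∃ m, n = m + 1 := ⟨n - 1, by have := NeZero.ne n; omega⟩
  have hz : ‖(z : ℂ)‖ < 1 := mem_ball_zero_iff.1 z.2
  have hζ : ‖(ζ : ℂ)‖ < 1 := mem_ball_zero_iff.1 ζ.2
  have hc : ∀ j, bergmanWeight (m+1) j = ((j + m).choose m : ℝ)⁻¹ := fun j => by
    have e1 : j + (m + 1) - 1 = j + m := by omega
    rw [bergmanWeight, e1, Nat.choose_symm_add]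
  have hc0 : ∀ j, ((j + m).choose m : ℝ) ≠ 0 := fun j => by
    have : 0 < (j+m).choose m := Nat.choose_pos (by omega)
    positivity
  ext y
  let a : ℕ → Y := fun j => (((j + m).choose m : ℂ) * conj (ζ : ℂ) ^ j) • y
  have ha : Summable fun j => bergmanWeight (m+1) j * ‖a j‖ ^ 2 := by
    have := summable_choose_mul_geometric_of_norm_lt_one (R := ℝ) m (r := ‖(ζ:ℂ)‖^2)
      (by rw [Real.norm_of_nonneg (by positivity)]; nlinarith [norm_nonneg (ζ:ℂ)])
    refine (this.mul_right (‖y‖^2)).congr fun j => ?_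
    simp only [a, norm_smul, norm_mul, norm_pow, RCLike.norm_conj, Complex.norm_natCast, hc]
    have := hc0 j
    field_simp
    ring
  have hk : RKHS.kerFun (Bergman (m+1) Y) ζ y = ofCoeff a ha := by
    refine ext_inner_right ℂ fun f => ?_
    rw [RKHS.kerFun_inner, inner_def, apply_eq, ← innerSL_apply_apply ℂ,
      (innerSL ℂ y).map_tsum (hasSum_pow_smul_coeff hζ f).summable]
    refine tsum_congr fun j => ?_
    simp only [coeff_ofCoeff, a, hc]
    rw [inner_smul_left]
    have : ((j + m).choose m : ℂ) ≠ 0 := by exact_mod_cast hc0 j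
    simp
    field_simp
  rw [← RKHS.kerFun_apply, hk, apply_eq]
  simp only [coeff_ofCoeff, a, smul_smul]
  have hlt : ‖(z : ℂ) * conj (ζ : ℂ)‖ < 1 := by
    rw [norm_mul, RCLike.norm_conj]; nlinarith [norm_nonneg (z:ℂ), norm_nonneg (ζ:ℂ)]
  have := (hasSum_choose_mul_geometric_of_norm_lt_one m hlt).smul_const y
  rw [FunLike.coe_smul, Pi.smul_apply, ContinuousLinearMap.id_apply, ← one_div, ← this.tsum_eq]
  refine tsum_congr fun j => ?_
  rw [mul_pow]
  congr 1
  ring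

end Functions

section Shift

variable {n : ℕ} [NeZero n] {Y : Type u} [NormedAddCommGroup Y] [InnerProductSpace ℂ Y]

/-- Taylor coefficients of `z f(z)`. -/
def shiftCoeff (a : ℕ → Y) : ℕ → Y
  | 0 => 0
  | j + 1 => a j

theorem weight_shift_le (f : Bergman n Y) (j : ℕ) :
    bergmanWeight n (j + 1) * ‖shiftCoeff f.coeff (j + 1)‖ ^ 2 ≤
      bergmanWeight n j * ‖f.coeff j‖ ^ 2 :=
  mul_le_mul_of_nonneg_right (bergmanWeight_succ_le n j) (sq_nonneg _)

theorem summable_weight_shift (f : Bergman n Y) :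
    Summable fun j => bergmanWeight n (j + 1) * ‖shiftCoeff f.coeff (j + 1)‖ ^ 2 :=
  Summable.of_nonneg_of_le
    (fun j => mul_nonneg (bergmanWeight_pos n (j + 1)).le (sq_nonneg _))
    (weight_shift_le f) f.summable_coeff

/-- The linear map `f(z) ↦ z f(z)`. -/
def shiftLinear (n : ℕ) [NeZero n] (Y : Type u) [NormedAddCommGroup Y] [InnerProductSpace ℂ Y] :
    Bergman n Y →ₗ[ℂ] Bergman n Y where
  toFun f := ofCoeff (shiftCoeff f.coeff)
    ((summable_nat_add_iff (f := fun j => bergmanWeight n j * ‖shiftCoeff f.coeff j‖ ^ 2) 1).1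
      (summable_weight_shift f))
  map_add' f g := coeff_ext fun j => by
    cases j with
    | zero => exact (add_zero (0 : Y)).symm
    | succ j => rfl
  map_smul' c f := coeff_ext fun j => by
    cases j with
    | zero => exact (smul_zero c).symm
    | succ j => rfl

theorem norm_shiftLinear_le (f : Bergman n Y) : ‖shiftLinear n Y f‖ ≤ 1 * ‖f‖ := by
  rw [one_mul]
  refine le_of_sq_le_sq ?_ (norm_nonneg _)
  have h := (shiftLinear n Y f).summable_coeff.tsum_eq_zero_add
  have h0 : (shiftLinear n Y f).coeff 0 = 0 := rfl
  rw [norm_sq_eq, norm_sq_eq, h, h0, norm_zero, zero_pow two_ne_zero, mul_zero, zero_add]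
  exact (summable_weight_shift f).tsum_le_tsum (weight_shift_le f) f.summable_coeff

/-- The Bergman shift `S_n : f(z) ↦ z f(z)` on `𝒜_n(Y)`. -/
def shift (n : ℕ) [NeZero n] (Y : Type u) [NormedAddCommGroup Y] [InnerProductSpace ℂ Y] :
    Bergman n Y →L[ℂ] Bergman n Y :=
  LinearMap.mkContinuous (shiftLinear n Y) 1 norm_shiftLinear_le

theorem shift_apply [CompleteSpace Y] (f : Bergman n Y) (z : Metric.ball (0 : ℂ) 1) :
    shift n Y f z = (z : ℂ) • f z := by
  have hz : ‖(z : ℂ)‖ < 1 := mem_ball_zero_iff.1 z.2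
  have hs := hasSum_pow_smul_coeff hz f
  rw [apply_eq, apply_eq, (hasSum_pow_smul_coeff hz (shift n Y f)).summable.tsum_eq_zero_add,
    ← hs.summable.tsum_const_smul]
  have h0 : (z : ℂ) ^ 0 • (shift n Y f).coeff 0 = 0 := smul_zero _
  rw [h0, zero_add]
  refine tsum_congr fun j => ?_
  rw [smul_smul, ← pow_succ']
  rfl

end Shift

end Bergman

/-- `k` is the reproducing kernel of the subspace `M` of the reproducing kernel Hilbert space `H`:
`k(·, ζ) y` lies in `M`, and `⟪k(·, ζ) y, f⟫ = ⟪y, f(ζ)⟫` for all `f ∈ M`. -/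
def IsReproducingKernelOf {H X V : Type*} [NormedAddCommGroup V] [InnerProductSpace ℂ V]
    [NormedAddCommGroup H] [InnerProductSpace ℂ H] [RKHS ℂ H X V]
    (M : Submodule ℂ H) (k : X → X → V →L[ℂ] V) : Prop :=
  ∀ (ζ : X) (y : V), ∃ g ∈ M, (∀ z, g z = k z ζ y) ∧ ∀ f ∈ M, ⟪g, f⟫_ℂ = ⟪y, f ζ⟫_ℂ

/-- A partial isometry: isometric on the orthogonal complement of its kernel. -/
def IsPartialIsometry {H K : Type*} [NormedAddCommGroup H] [InnerProductSpace ℂ H]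
    [NormedAddCommGroup K] [InnerProductSpace ℂ K] (T : H →L[ℂ] K) : Prop :=
  ∀ x ∈ (LinearMap.ker T.toLinearMap)ᗮ, ‖T x‖ = ‖x‖

section Systems

variable {X U Y Z : Type*}
  [NormedAddCommGroup X] [InnerProductSpace ℂ X] [CompleteSpace X]
  [NormedAddCommGroup U] [InnerProductSpace ℂ U]
  [NormedAddCommGroup Y] [InnerProductSpace ℂ Y] [CompleteSpace Y]
  [NormedAddCommGroup Z] [InnerProductSpace ℂ Z]

/-- `G = ∑_k binom(k+m-1, k) A^{*k} C^* C A^k` in the strong operator topology, i.e. `G` is the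
observability gramian of order `m` of `(C, A)`. For `m = 0` the truncated subtraction makes all
terms with `k ≥ 1` vanish, so that `G = C^* C`. -/
def IsObservabilityGramian (C : X →L[ℂ] Y) (A : X →L[ℂ] X) (m : ℕ) (G : X →L[ℂ] X) : Prop :=
  ∀ x : X, HasSum
    (fun k : ℕ => ((k + m - 1).choose k : ℂ) • ((A ^ k).adjoint (C.adjoint (C ((A ^ k) x))))) (G x)

/-- The block operator `[A B; C D] : X ⊕ U → X ⊕ Z` is unitary. -/
def IsUnitaryColligation (A : X →L[ℂ] X) (B : U →L[ℂ] X) (C : X →L[ℂ] Z) (D : U →L[ℂ] Z) : Prop :=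
  ∃ W : WithLp 2 (X × U) ≃ₗᵢ[ℂ] WithLp 2 (X × Z),
    ∀ x u, W (WithLp.toLp 2 (x, u)) = WithLp.toLp 2 (A x + B u, C x + D u)

/-- The transfer function `D + z C (I - zA)⁻¹ B`. -/
def transferFunction (A : X →L[ℂ] X) (B : U →L[ℂ] X) (C : X →L[ℂ] Z) (D : U →L[ℂ] Z) (z : ℂ) :
    U →L[ℂ] Z :=
  D + z • (C ∘L Ring.inverse (1 - z • A) ∘L B)

/-- `Ψ` is obtained from `(Q, A)` by a unitary completion with respect to the weight `R`:
on the unit disk it is the transfer function of a unitary colligation `[A' B; C' D]` whose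
first column is `[R A R⁻¹; Q R⁻¹]`, in the sense that `A' R = R A` and `C' R = Q`
(these determine `A'` and `C'` when `R` has dense range). -/
def IsUnitaryCompletion (A R : X →L[ℂ] X) (Q : X →L[ℂ] Z) (Ψ : ℂ → U →L[ℂ] Z) : Prop :=
  ∃ (A' : X →L[ℂ] X) (B : U →L[ℂ] X) (C' : X →L[ℂ] Z) (D : U →L[ℂ] Z),
    A' ∘L R = R ∘L A ∧ C' ∘L R = Q ∧ IsUnitaryColligation A' B C' D ∧
    ∀ z : ℂ, ‖z‖ < 1 → Ψ z = transferFunction A' B C' D z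

/-- The functions `F_ℓ` (`ℓ = i + 1`, `i : Fin n`) are obtained from the output pair `(C, A)` by
iterated unitary completions. With `G_m` the gramians of `(C, A)` and `Ψ_m` a unitary completion of
`[G_m^{1/2} A G_m^{-1/2}; G_{m-1}^{1/2} G_m^{-1/2}]` for `2 ≤ m ≤ n` and of
`[G_1^{1/2} A G_1^{-1/2}; C G_1^{-1/2}]` for `m = 1`:
`F_n = Ψ_1`, and `F_ℓ(z) = C (I - zA)^{-(n-ℓ)} G_{n-ℓ}^{-1/2} Ψ_{n+1-ℓ}(z)` for `ℓ < n`, where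
`N z = C (I - zA)^{-(n-ℓ)} G_{n-ℓ}^{-1/2}` is the bounded operator with
`(N z) G_{n-ℓ}^{1/2} = C (I - zA)^{-(n-ℓ)}`. -/
def HasIteratedRealization {n : ℕ} {U : Fin n → Type*}
    [∀ i, NormedAddCommGroup (U i)] [∀ i, InnerProductSpace ℂ (U i)]
    (C : X →L[ℂ] Y) (A : X →L[ℂ] X) (F : ∀ i, ℂ → U i →L[ℂ] Y) : Prop :=
  ∃ G : ℕ → X →L[ℂ] X,
    (∀ m ≤ n, IsObservabilityGramian C A m (G m)) ∧
    (∀ i : Fin n, (i : ℕ) + 1 = n → IsUnitaryCompletion A (CFC.sqrt (G 1)) C (F i)) ∧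
    (∀ i : Fin n, (i : ℕ) + 1 < n → ∃ Ψ : ℂ → U i →L[ℂ] X,
      IsUnitaryCompletion A (CFC.sqrt (G (n - (i : ℕ)))) (CFC.sqrt (G (n - ((i : ℕ) + 1)))) Ψ ∧
      ∃ N : ℂ → X →L[ℂ] Y, ∀ z : ℂ, ‖z‖ < 1 →
        N z ∘L CFC.sqrt (G (n - ((i : ℕ) + 1))) = C ∘L Ring.inverse (1 - z • A) ^ (n - ((i : ℕ) + 1)) ∧
        F i z = N z ∘L Ψ z)

end Systems

section Model

variable {n : ℕ} [NeZero n] {Y : Type u} [NormedAddCommGroup Y] [InnerProductSpace ℂ Y]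
  [CompleteSpace Y]

theorem adjoint_shift_mem_orthogonal (M : Submodule ℂ (Bergman n Y))
    (hM : ∀ f ∈ M, Bergman.shift n Y f ∈ M) (x : Mᗮ) :
    (Bergman.shift n Y).adjoint x ∈ Mᗮ := by
  rw [Submodule.mem_orthogonal]
  intro f hf
  rw [ContinuousLinearMap.adjoint_inner_right]
  exact (Submodule.mem_orthogonal M _).1 x.2 _ (hM f hf)

/-- The state operator `S_n^*|_{M^⊥}` of the model output pair of a shift-invariant subspace. -/
def modelState (M : Submodule ℂ (Bergman n Y)) (hM : ∀ f ∈ M, Bergman.shift n Y f ∈ M) :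
    Mᗮ →L[ℂ] Mᗮ :=
  ((Bergman.shift n Y).adjoint ∘L Mᗮ.subtypeL).codRestrict Mᗮ (adjoint_shift_mem_orthogonal M hM)

/-- The output operator `f ↦ f(0)` on `M^⊥` of the model output pair. -/
def modelOutput (M : Submodule ℂ (Bergman n Y)) : Mᗮ →L[ℂ] Y :=
  Bergman.eval ⟨0, Metric.mem_ball_self one_pos⟩ ∘L Mᗮ.subtypeL

end Model

/-- `T = M_F = [M_{F_1} ⋯ M_{F_n}] : ⨁_{j=1}^n 𝒜_j(U_j) → 𝒜_n(Y)` is the multiplication operator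
`(h_1, …, h_n) ↦ F_1 h_1 + ⋯ + F_n h_n`; the index `j : Fin n` stands for `j + 1`. -/
def IsMultiplicationOperator {n : ℕ} [NeZero n] {Y : Type u}
    [NormedAddCommGroup Y] [InnerProductSpace ℂ Y] [CompleteSpace Y] {U : Fin n → Type u}
    [∀ j, NormedAddCommGroup (U j)] [∀ j, InnerProductSpace ℂ (U j)] [∀ j, CompleteSpace (U j)]
    (F : ∀ j, ℂ → U j →L[ℂ] Y)
    (T : PiLp 2 (fun j : Fin n => Bergman ((j : ℕ) + 1) (U j)) →L[ℂ] Bergman n Y) : Prop :=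
  ∀ (h : PiLp 2 (fun j : Fin n => Bergman ((j : ℕ) + 1) (U j))) (z : Metric.ball (0 : ℂ) 1),
    T h z = ∑ j, F j z (h j z)

end

/-! Put `X = Mᗮ`, `A = S_n^*|_X`, `C f = f(0)`. The adjoint shift divides out Bergman weights, so `C
A^k f` is the `k`-th Taylor coefficient of `f` times its weight. Two facts follow: the gramian `G_n`
of `(C, A)` is the identity, and `C (I - zA)⁻ⁿ` is point evaluation at `z` on `X`.

Pascal's rule gives `G_{m+1} = A^* G_{m+1} A + G_m`. Hence `G_{m+1}^{1/2} x ↦ (G_{m+1}^{1/2} A x,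
G_m^{1/2} x)` is isometric on a dense range (for `m = 0` the second entry is `C x`). It extends to
an isometry on `X`, and adjoining the complement of its range as input space makes it unitary. The
transfer function `Ψ` of this colligation satisfies `I - Ψ(z) Ψ(w)^* = (1 - z w̄) E(z) E(w)^*`,
where `E` is the output operator times the resolvent. Multiplying by `N_m(z)` on the left and
`N_m(w)^*` on the right, with `N_0 = I`, gives `N_m(z) N_m(w)^* - F(z) F(w)^* = (1 - z w̄)
N_{m+1}(z) N_{m+1}(w)^*`, where `F = N_m Ψ` has index `n - m`.

Dividing by the appropriate powers of `1 - z w̄` and summing, everything telescopes to `I / (1 - z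
w̄)^n - N_n(z) N_n(w)^*`. Since `G_n = I`, this is the kernel of `𝒜_n(Y)` minus that of `Mᗮ`, which
is the kernel of `M`.

The kernel identity is an equality of Gram matrices, so it yields an isometry from `M` into `⨁
𝒜_j(U_j)`; its adjoint is `M_F`. The main steps are `exists_isUnitaryCompletion`,
`IsNormalizedPair.exists_hasIteratedRealization` and `exists_isMultiplicationOperator`. -/

noncomputable section

/-! ### Extension of isometries from a dense range -/

section Extension

variable {E H K : Type*} [NormedAddCommGroup H] [InnerProductSpace ℂ H]
  [NormedAddCommGroup K] [InnerProductSpace ℂ K] [CompleteSpace K]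

/-- A norm-preserving correspondence defined on a dense range extends to a linear isometry. -/
theorem exists_linearIsometry_of_norm_eq [AddCommGroup E] [Module ℂ E] (f : E →ₗ[ℂ] H)
    (g : E →ₗ[ℂ] K) (hf : DenseRange f) (hfg : ∀ x, ‖g x‖ = ‖f x‖) :
    ∃ V : H →ₗᵢ[ℂ] K, ∀ x, V (f x) = g x := by
  have hV : ∀ x, g.extendOfNorm f (f x) = g x :=
    LinearMap.extendOfNorm_eq hf ⟨1, fun x => by rw [one_mul, hfg]⟩
  refine ⟨⟨(g.extendOfNorm f).toLinearMap, fun x => ?_⟩, hV⟩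
  refine hf.induction_on (p := fun x => ‖g.extendOfNorm f x‖ = ‖x‖) x
    (isClosed_eq (by fun_prop) (by fun_prop)) fun x => ?_
  rw [hV, hfg]

end Extension

/-! ### Resolvents of contractions on the disk -/

section Resolvent

variable {X : Type*} [NormedAddCommGroup X] [InnerProductSpace ℂ X] [CompleteSpace X]

theorem norm_smul_lt_one_of_contraction {A : X →L[ℂ] X} (hA : ‖A‖ ≤ 1) {z : ℂ} (hz : ‖z‖ < 1) :
    ‖z • A‖ < 1 := by
  rw [norm_smul]
  exact (mul_le_of_le_one_right (norm_nonneg z) hA).trans_lt hz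

theorem isUnit_one_sub_smul_of_contraction {A : X →L[ℂ] X} (hA : ‖A‖ ≤ 1) {z : ℂ}
    (hz : ‖z‖ < 1) : IsUnit (1 - z • A) :=
  isUnit_one_sub_of_norm_lt_one (norm_smul_lt_one_of_contraction hA hz)

theorem differentiableOn_inverse_one_sub_smul {A : X →L[ℂ] X} (hA : ‖A‖ ≤ 1) :
    DifferentiableOn ℂ (fun z : ℂ => Ring.inverse (1 - z • A)) (Metric.ball 0 1) := by
  intro z hz
  have hu := isUnit_one_sub_smul_of_contraction hA (mem_ball_zero_iff.1 hz)
  have h1 : DifferentiableAt ℂ (Ring.inverse : (X →L[ℂ] X) → _) (1 - z • A) := by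
    exact differentiableAt_inverse hu
  have h2 : DifferentiableAt ℂ (fun z : ℂ => 1 - z • A) z := by fun_prop
  exact (h1.comp z h2).differentiableWithinAt

/-- Intertwining passes to resolvents. -/
theorem inverse_one_sub_smul_comp_of_intertwine {A A' R : X →L[ℂ] X} (hA : ‖A‖ ≤ 1)
    (hA' : ‖A'‖ ≤ 1) (h : A' ∘L R = R ∘L A) {z : ℂ} (hz : ‖z‖ < 1) :
    Ring.inverse (1 - z • A') ∘L R = R ∘L Ring.inverse (1 - z • A) := by
  have hu := isUnit_one_sub_smul_of_contraction hA hz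
  have hu' := isUnit_one_sub_smul_of_contraction hA' hz
  have h' : A' * R = R * A := h
  have key : (1 - z • A') * R = R * (1 - z • A) := by
    rw [sub_mul, mul_sub, one_mul, mul_one, smul_mul_assoc, mul_smul_comm, h']
  change Ring.inverse (1 - z • A') * R = R * Ring.inverse (1 - z • A)
  calc Ring.inverse (1 - z • A') * R
      = Ring.inverse (1 - z • A') * (R * (1 - z • A)) * Ring.inverse (1 - z • A) := by
        rw [mul_assoc, mul_assoc R, Ring.mul_inverse_cancel _ hu, mul_one]
    _ = R * Ring.inverse (1 - z • A) := by
        rw [← key, ← mul_assoc (Ring.inverse _), Ring.inverse_mul_cancel _ hu', one_mul]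

end Resolvent

/-! ### Unitary colligations and their transfer functions -/

section Colligation

variable {X U Z : Type*}
  [NormedAddCommGroup X] [InnerProductSpace ℂ X] [CompleteSpace X]
  [NormedAddCommGroup U] [InnerProductSpace ℂ U] [CompleteSpace U]
  [NormedAddCommGroup Z] [InnerProductSpace ℂ Z] [CompleteSpace Z]

/-- An isometry `V : X → X ⊕ Z` is the first column of a unitary colligation whose input space
is the defect space `(range V)ᗮ`. -/
theorem isUnitaryColligation_of_linearIsometry (V : X →ₗᵢ[ℂ] WithLp 2 (X × Z)) :
    IsUnitaryColligation
      (WithLp.fstL 2 ℂ X Z ∘L V.toContinuousLinearMap)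
      (WithLp.fstL 2 ℂ X Z ∘L (LinearMap.range V.toLinearMap)ᗮ.subtypeL)
      (WithLp.sndL 2 ℂ X Z ∘L V.toContinuousLinearMap)
      (WithLp.sndL 2 ℂ X Z ∘L (LinearMap.range V.toLinearMap)ᗮ.subtypeL) := by
  set S := LinearMap.range V.toLinearMap
  have hVS : ∀ x, V x ∈ S := fun x => ⟨x, rfl⟩
  let L : WithLp 2 (X × Sᗮ) →ₗ[ℂ] WithLp 2 (X × Z) :=
    V.toLinearMap ∘ₗ (WithLp.fstL 2 ℂ X Sᗮ).toLinearMap +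
      Sᗮ.subtype ∘ₗ (WithLp.sndL 2 ℂ X Sᗮ).toLinearMap
  have hL : ∀ p, L p = V p.fst + (p.snd : WithLp 2 (X × Z)) := fun p => rfl
  have hnorm : ∀ p, ‖L p‖ = ‖p‖ := fun p => by
    refine (sq_eq_sq₀ (norm_nonneg _) (norm_nonneg _)).1 ?_
    rw [hL, WithLp.prod_norm_sq_eq_of_L2 p, sq, norm_add_sq_eq_norm_sq_add_norm_sq_of_inner_eq_zero
      (𝕜 := ℂ), V.norm_map, Submodule.coe_norm, sq, sq]
    exact (Submodule.mem_orthogonal S _).1 p.snd.2 _ (hVS _)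
  -- `X` is complete, so the isometric image is closed; this is what makes `S` and its orthogonal
  -- complement span the whole target.
  have hcl : IsClosed (S : Set (WithLp 2 (X × Z))) := V.isometry.isClosedEmbedding.isClosed_range
  have : CompleteSpace S := hcl.completeSpace_coe
  have hsurj : Function.Surjective L := fun q => by
    obtain ⟨x, hx⟩ : S.starProjection q ∈ S := Submodule.starProjection_apply_mem S q
    refine ⟨WithLp.toLp 2 (x, ⟨q - S.starProjection q,
      Submodule.sub_starProjection_mem_orthogonal q⟩), ?_⟩
    rw [hL]
    change V x + (q - S.starProjection q) = q
    rw [show V x = S.starProjection q from hx]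
    abel
  refine ⟨LinearIsometryEquiv.ofSurjective ⟨L, hnorm⟩ hsurj, fun x u => ?_⟩
  rfl

/-- The Christoffel–Darboux type identity of a coisometric colligation. -/
theorem transferFunction_kernel_inner {A : X →L[ℂ] X} {B : U →L[ℂ] X} {C : X →L[ℂ] Z}
    {D : U →L[ℂ] Z} (hW : IsUnitaryColligation A B C D) (hA : ‖A‖ ≤ 1) {z w : ℂ}
    (hz : ‖z‖ < 1) (hw : ‖w‖ < 1) (y y' : Z) :
    ⟪y, y'⟫_ℂ - ⟪(transferFunction A B C D z).adjoint y,
        (transferFunction A B C D w).adjoint y'⟫_ℂ =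
      (1 - z * conj w) * ⟪(C ∘L Ring.inverse (1 - z • A)).adjoint y,
        (C ∘L Ring.inverse (1 - w • A)).adjoint y'⟫_ℂ := by
  obtain ⟨W, hW⟩ := hW
  -- With `E = C (I - zA)⁻¹`, this is the adjoint form of the row identity `[zE I] W = [E Ψ(z)]`.
  -- Its first entry is the resolvent identity `E = zEA + C`, its second the definition of `Ψ`. The
  -- lemma then follows because `W⁻¹` preserves inner products.
  have key : ∀ {z : ℂ}, ‖z‖ < 1 → ∀ y : Z,
      W.symm (WithLp.toLp 2 (conj z • (C ∘L Ring.inverse (1 - z • A)).adjoint y, y)) =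
        WithLp.toLp 2 ((C ∘L Ring.inverse (1 - z • A)).adjoint y,
          (transferFunction A B C D z).adjoint y) := by
    intro z hz y
    refine ext_inner_left ℂ fun p => ?_
    rw [← W.inner_map_eq_flip]
    have hp : p = WithLp.toLp 2 (p.fst, p.snd) := rfl
    have hres : ∀ x, C (Ring.inverse (1 - z • A) x) =
        z • C (Ring.inverse (1 - z • A) (A x)) + C x := fun x => by
      have h1 := Ring.inverse_mul_cancel _ (isUnit_one_sub_smul_of_contraction hA hz)
      have h2 : Ring.inverse (1 - z • A) (x - z • A x) = x := congrArg (fun T => T x) h1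
      have h3 := congrArg C h2
      rw [map_sub, map_sub, map_smul, map_smul] at h3
      rw [← h3]
      abel
    rw [hp, hW]
    simp only [WithLp.prod_inner_apply, inner_smul_right, ContinuousLinearMap.adjoint_inner_right,
      ContinuousLinearMap.comp_apply, transferFunction, FunLike.coe_add, Pi.add_apply,
      FunLike.coe_smul, Pi.smul_apply]
    rw [hres p.fst]
    simp only [map_add, inner_add_left, inner_smul_left]
    ring
  have h := W.symm.inner_map_map
    (WithLp.toLp 2 (conj z • (C ∘L Ring.inverse (1 - z • A)).adjoint y, y))
    (WithLp.toLp 2 (conj w • (C ∘L Ring.inverse (1 - w • A)).adjoint y', y'))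
  rw [key hz, key hw] at h
  simp only [WithLp.prod_inner_apply, inner_smul_left, inner_smul_right, Complex.conj_conj] at h
  linear_combination -h

end Colligation

/-! ### Unitary completion of a weighted isometric column -/

section Completion

variable {X Z Y : Type u}
  [NormedAddCommGroup X] [InnerProductSpace ℂ X] [CompleteSpace X]
  [NormedAddCommGroup Z] [InnerProductSpace ℂ Z] [CompleteSpace Z]
  [NormedAddCommGroup Y] [InnerProductSpace ℂ Y] [CompleteSpace Y]

/-- If `R² = A^* R² A + Q^* Q` with `R` of dense range, then `(Q, A)` has a unitary completion `Ψ`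
with weight `R`; if moreover `N₀(z) Q (I - zA)⁻¹ = N₁(z) R` on the disk, the kernels of `N₀`,
`N₀ Ψ` and `N₁` are related by a Christoffel–Darboux type identity. -/
theorem exists_isUnitaryCompletion {A R : X →L[ℂ] X} {Q : X →L[ℂ] Z} (hA : ‖A‖ ≤ 1)
    (hR : DenseRange R) (hRAQ : ∀ x, ‖R x‖ ^ 2 = ‖R (A x)‖ ^ 2 + ‖Q x‖ ^ 2)
    {N₀ : ℂ → Z →L[ℂ] Y} {N₁ : ℂ → X →L[ℂ] Y}
    (hN : ∀ z : ℂ, ‖z‖ < 1 → N₀ z ∘L Q ∘L Ring.inverse (1 - z • A) = N₁ z ∘L R) :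
    ∃ (U : Type u) (_ : NormedAddCommGroup U) (_ : InnerProductSpace ℂ U) (_ : CompleteSpace U)
      (Ψ : ℂ → U →L[ℂ] Z), IsUnitaryCompletion A R Q Ψ ∧
      DifferentiableOn ℂ Ψ (Metric.ball 0 1) ∧
      ∀ z w : ℂ, ‖z‖ < 1 → ‖w‖ < 1 → ∀ y y' : Y,
        ⟪(N₀ z).adjoint y, (N₀ w).adjoint y'⟫_ℂ -
          ⟪(N₀ z ∘L Ψ z).adjoint y, (N₀ w ∘L Ψ w).adjoint y'⟫_ℂ =
        (1 - z * conj w) * ⟪(N₁ z).adjoint y, (N₁ w).adjoint y'⟫_ℂ := by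
  -- The column `[R A; Q]`; by `hRAQ` it has the same norms as `R`, so `V` plays the role of `[R A;
  -- Q] R⁻¹` although `R` need not be invertible.
  let g : X →ₗ[ℂ] WithLp 2 (X × Z) :=
    (WithLp.linearEquiv 2 ℂ (X × Z)).symm.toLinearMap ∘ₗ (R ∘L A).toLinearMap.prod Q.toLinearMap
  have hg : ∀ x, g x = WithLp.toLp 2 (R (A x), Q x) := fun x => rfl
  obtain ⟨V, hV⟩ := exists_linearIsometry_of_norm_eq R.toLinearMap g hR fun x => by
    refine (sq_eq_sq₀ (norm_nonneg _) (norm_nonneg _)).1 ?_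
    rw [hg, WithLp.prod_norm_sq_eq_of_L2]
    exact (hRAQ x).symm
  have hW := isUnitaryColligation_of_linearIsometry V
  set S := LinearMap.range V.toLinearMap
  set A' := WithLp.fstL 2 ℂ X Z ∘L V.toContinuousLinearMap
  set B := WithLp.fstL 2 ℂ X Z ∘L Sᗮ.subtypeL
  set C' := WithLp.sndL 2 ℂ X Z ∘L V.toContinuousLinearMap
  set D := WithLp.sndL 2 ℂ X Z ∘L Sᗮ.subtypeL
  have hA'R : A' ∘L R = R ∘L A := by
    ext x
    change (V (R x)).fst = R (A x)
    rw [show V (R x) = _ from hV x]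
    rfl
  have hC'R : C' ∘L R = Q := by
    ext x
    change (V (R x)).snd = Q x
    rw [show V (R x) = _ from hV x]
    rfl
  have hA' : ‖A'‖ ≤ 1 := by
    refine ContinuousLinearMap.opNorm_le_bound _ zero_le_one fun x => ?_
    rw [one_mul, ← V.norm_map x]
    refine le_of_sq_le_sq ?_ (norm_nonneg _)
    rw [WithLp.prod_norm_sq_eq_of_L2 (V x)]
    exact le_add_of_nonneg_right (sq_nonneg _)
  have hN' : ∀ z : ℂ, ‖z‖ < 1 → N₀ z ∘L (C' ∘L Ring.inverse (1 - z • A')) = N₁ z := by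
    intro z hz
    -- The two sides can only be compared after composing with `R`, where `A'` and `C'` turn into
    -- `A` and `Q`; density of the range of `R` then removes it.
    have h : (N₀ z ∘L (C' ∘L Ring.inverse (1 - z • A'))) ∘L R = N₁ z ∘L R := by
      rw [← hN z hz, ContinuousLinearMap.comp_assoc, ContinuousLinearMap.comp_assoc,
        inverse_one_sub_smul_comp_of_intertwine hA hA' hA'R hz,
        ← ContinuousLinearMap.comp_assoc C', hC'R]
    refine DFunLike.coe_injective (hR.equalizer (ContinuousLinearMap.continuous _)
      (ContinuousLinearMap.continuous _) ?_)
    funext x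
    exact congrArg (fun T => T x) h
  refine ⟨Sᗮ, inferInstance, inferInstance, inferInstance, transferFunction A' B C' D,
    ⟨A', B, C', D, hA'R, hC'R, hW, fun _ _ => rfl⟩, ?_, fun z w hz hw y y' => ?_⟩
  · have h := differentiableOn_inverse_one_sub_smul hA'
    have h' := (differentiableOn_const C').clm_comp (h.clm_comp (differentiableOn_const B))
    exact (differentiableOn_const D).add (differentiableOn_id.fun_smul h')
  · have h := transferFunction_kernel_inner hW hA' hz hw ((N₀ z).adjoint y) ((N₀ w).adjoint y')
    rw [← hN' z hz, ← hN' w hw]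
    simpa only [ContinuousLinearMap.adjoint_comp (N₀ _), ContinuousLinearMap.comp_apply] using h

end Completion

/-! ### Pascal's rule for series -/

section BinomialSums

/-- Pascal's rule for binomially weighted series. -/
theorem HasSum.choose_nsmul_sub {E : Type*} [AddCommGroup E] [TopologicalSpace E]
    [IsTopologicalAddGroup E] {m : ℕ} {a : ℕ → E} {s t : E}
    (hs : HasSum (fun k => (k + (m + 1) - 1).choose k • a k) s)
    (ht : HasSum (fun k => (k + (m + 1) - 1).choose k • a (k + 1)) t) :
    HasSum (fun k => (k + m - 1).choose k • a k) (s - t) := by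
  -- The second series moved one place to the right, with a zero in front, so that Pascal's rule
  -- applies term by term.
  let b : ℕ → E := fun k => k.casesOn 0 fun l => (l + (m + 1) - 1).choose l • a (l + 1)
  have hb : HasSum b t := by
    have h : HasSum (fun k => b (k + 1)) t := ht
    simpa [b] using (hasSum_nat_add_iff (f := b) 1).1 h
  refine (hs.sub hb).congr_fun fun k => ?_
  cases k with
  | zero => simp [b]
  | succ k =>
    have e1 : k + 1 + (m + 1) - 1 = k + m + 1 := by omega
    have e2 : k + (m + 1) - 1 = k + m := by omega
    have e3 : k + 1 + m - 1 = k + m := by omega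
    simp only [b]
    rw [e1, e2, e3, Nat.choose_succ_succ, add_smul]
    abel

end BinomialSums

/-! ### Holomorphy of evaluation, and monomials -/

namespace Bergman

variable {n : ℕ} [NeZero n] {Y : Type u} [NormedAddCommGroup Y] [InnerProductSpace ℂ Y]

/-- The Taylor coefficients as continuous linear maps. -/
def coeffCLM (n : ℕ) [NeZero n] (Y : Type u) [NormedAddCommGroup Y] [InnerProductSpace ℂ Y]
    (j : ℕ) : Bergman n Y →L[ℂ] Y :=
  LinearMap.mkContinuous ⟨⟨fun f => f.coeff j, fun _ _ => rfl⟩, fun _ _ => rfl⟩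
    (bergmanWeight n j)⁻¹ (fun f => norm_coeff_le f j)

/-- Evaluation composed with a contraction into `𝒜_n(Y)` is a holomorphic function of the
point. -/
theorem exists_differentiableOn_eval_comp [CompleteSpace Y] {X : Type*} [NormedAddCommGroup X]
    [InnerProductSpace ℂ X] (V : X →L[ℂ] Bergman n Y) (hV : ∀ x, ‖V x‖ ≤ ‖x‖) :
    ∃ N : ℂ → X →L[ℂ] Y, DifferentiableOn ℂ N (Metric.ball 0 1) ∧
      ∀ (z : Metric.ball (0 : ℂ) 1) (x : X), N z x = eval z (V x) := by
  let a : ℕ → X →L[ℂ] Y := fun j => coeffCLM n Y j ∘L V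
  have ha : ∀ j, ‖a j‖ ≤ (bergmanWeight n j)⁻¹ := fun j => by
    have hw := (inv_pos.2 (bergmanWeight_pos n j)).le
    exact ContinuousLinearMap.opNorm_le_bound _ hw fun x =>
      (norm_coeff_le (V x) j).trans (mul_le_mul_of_nonneg_left (hV x) hw)
  have hb : ∀ {z : ℂ} {r : ℝ}, ‖z‖ ≤ r → ∀ j,
      ‖z ^ j • a j‖ ≤ r ^ j * (bergmanWeight n j)⁻¹ := fun {z r} hz j => by
    rw [norm_smul, norm_pow]
    exact mul_le_mul (pow_le_pow_left₀ (norm_nonneg z) hz j) (ha j) (norm_nonneg _)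
      (pow_nonneg ((norm_nonneg z).trans hz) j)
  refine ⟨fun z => ∑' j, z ^ j • a j, fun z hz => ?_, fun z x => ?_⟩
  -- Differentiability is local: on a disk of radius `r < 1` around the origin the series has a
  -- summable bound independent of the point.
  · obtain ⟨r, hzr, hr⟩ := exists_between (mem_ball_zero_iff.1 hz)
    have hr0 : 0 ≤ r := (norm_nonneg z).trans hzr.le
    have h : DifferentiableOn ℂ (fun z : ℂ => ∑' j, z ^ j • a j) (Metric.ball 0 r) :=
      Complex.differentiableOn_tsum_of_summable_norm
        (summable_geometric_div_bergmanWeight n hr0 hr)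
        (fun j => by fun_prop) Metric.isOpen_ball
        fun j w hw => hb (mem_ball_zero_iff.1 hw).le j
    exact (h.differentiableAt
      (Metric.isOpen_ball.mem_nhds (mem_ball_zero_iff.2 hzr))).differentiableWithinAt
  · have hz : ‖(z : ℂ)‖ < 1 := mem_ball_zero_iff.1 z.2
    have hs : Summable fun j => (z : ℂ) ^ j • a j :=
      Summable.of_norm_bounded (summable_geometric_div_bergmanWeight n (norm_nonneg (z : ℂ)) hz)
        (hb le_rfl)
    exact (hs.hasSum.mapL (ContinuousLinearMap.apply ℂ Y x)).tsum_eq.symm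

/-- The monomial `y z^k`. -/
def monomial (n : ℕ) [NeZero n] {Y : Type u} [NormedAddCommGroup Y] [InnerProductSpace ℂ Y]
    (k : ℕ) (y : Y) : Bergman n Y :=
  ofCoeff (Pi.single k y) (summable_of_ne_finset_zero (s := {k}) fun j hj => by
    rw [Pi.single_eq_of_ne (by simpa using hj)]
    simp)

theorem monomial_inner (k : ℕ) (y : Y) (f : Bergman n Y) :
    ⟪monomial n k y, f⟫_ℂ = (bergmanWeight n k : ℂ) * ⟪y, f.coeff k⟫_ℂ := by
  rw [inner_def, tsum_eq_single k fun j hj => by simp [monomial, Pi.single_eq_of_ne hj]]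
  simp [monomial]

/-- Rescaling carries the monomial expansion to the expansion of an `ℓ²` sequence in its single
entries, and being isometric it reflects convergence. -/
theorem hasSum_monomial (f : Bergman n Y) :
    HasSum (fun k => monomial n k (f.coeff k)) f := by
  have hi : Isometry (toEll2 : Bergman n Y →ₗ[ℂ] lp (fun _ : ℕ => Y) 2) :=
    AddMonoidHomClass.isometry_of_norm _ norm_toEll2
  refine (hi.isUniformInducing.isInducing.hasSum_iff (g := toEll2) _ _).1 ?_
  refine (lp.hasSum_single (E := fun _ : ℕ => Y) ENNReal.ofNat_ne_top (toEll2 f)).congr_fun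
    fun k => ?_
  ext j
  by_cases hj : j = k
  · subst hj
    simp [toEll2_apply, monomial]
  · simp [toEll2_apply, monomial, hj]

theorem shift_monomial (k : ℕ) (y : Y) :
    shift n Y (monomial n k y) = monomial n (k + 1) y := by
  refine coeff_ext fun j => ?_
  rcases j with _ | j
  · simp [monomial]
    rfl
  · change (monomial n k y).coeff j = _
    by_cases h : j = k
    · subst h
      simp [monomial]
    · simp [monomial, h]

end Bergman

/-! ### Square roots of gramians -/

section SquareRoot

variable {X K : Type*} [NormedAddCommGroup X] [InnerProductSpace ℂ X] [CompleteSpace X]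
  [NormedAddCommGroup K] [InnerProductSpace ℂ K] [CompleteSpace K]

theorem isSelfAdjoint_sqrt (G : X →L[ℂ] X) : IsSelfAdjoint (CFC.sqrt G) := by
  have h : (0 : X →L[ℂ] X) ≤ CFC.sqrt G := CFC.sqrt_nonneg _
  exact ((ContinuousLinearMap.nonneg_iff_isPositive _).1 h).isSelfAdjoint

theorem sqrt_adjoint_comp_mul_self (O : X →L[ℂ] K) :
    CFC.sqrt (O.adjoint ∘L O) * CFC.sqrt (O.adjoint ∘L O) = O.adjoint ∘L O :=
  CFC.sqrt_mul_sqrt_self _ ((ContinuousLinearMap.nonneg_iff_isPositive _).2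
    (ContinuousLinearMap.isPositive_adjoint_comp_self O))

theorem norm_sqrt_adjoint_comp_apply (O : X →L[ℂ] K) (x : X) :
    ‖CFC.sqrt (O.adjoint ∘L O) x‖ = ‖O x‖ := by
  refine (sq_eq_sq₀ (norm_nonneg _) (norm_nonneg _)).1 ?_
  have h : ⟪CFC.sqrt (O.adjoint ∘L O) x, CFC.sqrt (O.adjoint ∘L O) x⟫_ℂ = ⟪O x, O x⟫_ℂ := by
    rw [← ContinuousLinearMap.adjoint_inner_right, (isSelfAdjoint_sqrt _).adjoint_eq,
      ← mul_apply_eq_comp, sqrt_adjoint_comp_mul_self, ContinuousLinearMap.comp_apply,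
      ContinuousLinearMap.adjoint_inner_right]
  rw [inner_self_eq_norm_sq_to_K, inner_self_eq_norm_sq_to_K] at h
  exact_mod_cast h

/-- The square root has the same norms, hence the same kernel, as `O`; a self-adjoint operator with
trivial kernel has dense range. -/
theorem denseRange_sqrt_adjoint_comp {O : X →L[ℂ] K} (hO : ∀ x, O x = 0 → x = 0) :
    DenseRange (CFC.sqrt (O.adjoint ∘L O) : X →L[ℂ] X) := by
  have h : (LinearMap.range (CFC.sqrt (O.adjoint ∘L O) : X →L[ℂ] X).toLinearMap).topologicalClosure = ⊤ := by
    rw [Submodule.topologicalClosure_eq_top_iff, ContinuousLinearMap.orthogonal_range,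
      (isSelfAdjoint_sqrt _).adjoint_eq, LinearMap.ker_eq_bot']
    intro x hx
    refine hO x (norm_eq_zero.1 ?_)
    rw [← norm_sqrt_adjoint_comp_apply]
    exact norm_eq_zero.2 hx
  exact Submodule.dense_iff_topologicalClosure_eq_top.2 h

end SquareRoot

/-! ### Observability operators, gramians and resolvent series -/

section Observability

variable {X : Type*} [NormedAddCommGroup X] [InnerProductSpace ℂ X]
  {Y : Type u} [NormedAddCommGroup Y] [InnerProductSpace ℂ Y]
  {C : X →L[ℂ] Y} {A : X →L[ℂ] X} {m n : ℕ}

/-- `O` is the observability operator `x ↦ C (I - zA)⁻ᵐ x` into `𝒜_m(Y)`. -/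
def IsObservabilityOperator [NeZero m] (C : X →L[ℂ] Y) (A : X →L[ℂ] X)
    (O : X →L[ℂ] Bergman m Y) : Prop :=
  ∀ x k, (O x).coeff k = ((k + m - 1).choose k : ℂ) • C ((A ^ k) x)

theorem IsObservabilityOperator.hasSum_norm_sq [NeZero m] {O : X →L[ℂ] Bergman m Y}
    (hO : IsObservabilityOperator C A O) (x : X) :
    HasSum (fun k => (k + m - 1).choose k • ‖C ((A ^ k) x)‖ ^ 2) (‖O x‖ ^ 2) := by
  rw [Bergman.norm_sq_eq]
  refine (O x).summable_coeff.hasSum.congr_fun fun k => ?_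
  have h := bergmanWeight_pos m k
  rw [bergmanWeight, inv_pos] at h
  rw [hO, norm_smul, Complex.norm_natCast, bergmanWeight, nsmul_eq_mul]
  field_simp

/-- The Stein identity `G_{m+1} = A^* G_{m+1} A + G_m` in quadratic-form version: replacing `x` by
`A x` shifts the outputs by one, so Pascal's rule lowers the order. -/
theorem IsObservabilityOperator.norm_sq_succ {O' : X →L[ℂ] Bergman (m + 1) Y}
    (hO' : IsObservabilityOperator C A O') {x : X} {s : ℝ}
    (hs : HasSum (fun k => (k + m - 1).choose k • ‖C ((A ^ k) x)‖ ^ 2) s) :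
    ‖O' x‖ ^ 2 = ‖O' (A x)‖ ^ 2 + s := by
  have h1 := HasSum.choose_nsmul_sub (a := fun k => ‖C ((A ^ k) x)‖ ^ 2) (hO'.hasSum_norm_sq x)
    ((hO'.hasSum_norm_sq (A x)).congr_fun fun k => by
      rw [pow_succ A]
      rfl)
  linarith [h1.unique hs]

/-- The normalization, `∑ binom(k+n-1, k) ‖C A^k x‖² = ‖x‖²`, i.e. the
gramian of order `n` is the identity. -/
def IsNormalizedPair (n : ℕ) (C : X →L[ℂ] Y) (A : X →L[ℂ] X) : Prop :=
  ∀ x, HasSum (fun k => (k + n - 1).choose k • ‖C ((A ^ k) x)‖ ^ 2) (‖x‖ ^ 2)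

/-- The binomials increase with the order, so the series of order `m` is dominated by that of order
`n`, whose sum is `‖x‖²`; the operator is thus a contraction. -/
theorem IsNormalizedPair.exists_isObservabilityOperator (h : IsNormalizedPair n C A) [NeZero m]
    (hmn : m ≤ n) : ∃ O : X →L[ℂ] Bergman m Y, IsObservabilityOperator C A O := by
  have hterm : ∀ x k, bergmanWeight m k * ‖((k + m - 1).choose k : ℂ) • C ((A ^ k) x)‖ ^ 2 =
      (k + m - 1).choose k • ‖C ((A ^ k) x)‖ ^ 2 := fun x k => by
    have h := bergmanWeight_pos m k
    rw [bergmanWeight, inv_pos] at h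
    rw [norm_smul, Complex.norm_natCast, bergmanWeight, nsmul_eq_mul]
    field_simp
  have hle : ∀ x k, (k + m - 1).choose k • ‖C ((A ^ k) x)‖ ^ 2 ≤
      (k + n - 1).choose k • ‖C ((A ^ k) x)‖ ^ 2 := fun x k =>
    nsmul_le_nsmul_left (sq_nonneg _) (Nat.choose_le_choose k (by omega))
  have hs : ∀ x, Summable fun k => (k + m - 1).choose k • ‖C ((A ^ k) x)‖ ^ 2 := fun x =>
    Summable.of_nonneg_of_le (fun k => by positivity) (hle x) (h x).summable
  let L : X →ₗ[ℂ] Bergman m Y :=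
    { toFun := fun x => Bergman.ofCoeff (fun k => ((k + m - 1).choose k : ℂ) • C ((A ^ k) x))
        ((hs x).congr fun k => (hterm x k).symm)
      map_add' := fun x y => Bergman.coeff_ext fun k => by simp
      map_smul' := fun c x => Bergman.coeff_ext fun k => by simp [smul_comm c] }
  refine ⟨L.mkContinuous 1 fun x => ?_, fun x k => rfl⟩
  rw [one_mul]
  refine le_of_sq_le_sq ?_ (norm_nonneg _)
  rw [Bergman.norm_sq_eq, ← (h x).tsum_eq]
  refine (((hs x).tsum_le_tsum (hle x) (h x).summable).trans_eq' ?_)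
  exact tsum_congr fun k => (hterm x k).symm

/-- If `O x` vanishes then so do all outputs `C A^k x`, and the normalization expresses `‖x‖²`
through these. -/
theorem IsNormalizedPair.eq_zero (h : IsNormalizedPair n C A) [NeZero m]
    {O : X →L[ℂ] Bergman m Y} (hO : IsObservabilityOperator C A O) {x : X} (hx : O x = 0) :
    x = 0 := by
  have h0 : ∀ k, C ((A ^ k) x) = 0 := fun k => by
    have h1 := hO x k
    have h2 := (bergmanWeight_pos m k).ne'
    rw [bergmanWeight, ne_eq, inv_eq_zero] at h2
    rw [hx, Bergman.coeff_zero] at h1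
    exact (smul_eq_zero.1 h1.symm).resolve_left (by exact_mod_cast h2)
  have h1 := h x
  simp only [h0, norm_zero, ne_eq, OfNat.ofNat_ne_zero, not_false_eq_true, zero_pow,
    smul_zero] at h1
  exact norm_eq_zero.1 (pow_eq_zero_iff two_ne_zero |>.1 (h1.unique hasSum_zero))

variable [CompleteSpace Y]

theorem IsObservabilityOperator.hasSum_eval [NeZero m] {O : X →L[ℂ] Bergman m Y}
    (hO : IsObservabilityOperator C A O) (z : Metric.ball (0 : ℂ) 1) (x : X) :
    HasSum (fun k => (k + m - 1).choose k • ((z : ℂ) ^ k • C ((A ^ k) x)))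
      (Bergman.eval z (O x)) := by
  refine (Bergman.hasSum_pow_smul_coeff (mem_ball_zero_iff.1 z.2) (O x)).congr_fun fun k => ?_
  rw [hO, smul_comm, Nat.cast_smul_eq_nsmul]

variable [CompleteSpace X]

/-- Apply `O^*` to the monomial expansion of `O x`. The Bergman weight cancels one of the two
binomial factors, leaving the other as the coefficient in the gramian. -/
theorem IsObservabilityOperator.isObservabilityGramian [NeZero m] {O : X →L[ℂ] Bergman m Y}
    (hO : IsObservabilityOperator C A O) :
    IsObservabilityGramian C A m (O.adjoint ∘L O) := by
  intro x
  refine ((Bergman.hasSum_monomial (O x)).mapL O.adjoint).congr_fun fun k => ?_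
  refine ext_inner_right ℂ fun v => ?_
  have h := (bergmanWeight_pos m k).ne'
  rw [bergmanWeight, ne_eq, inv_eq_zero] at h
  have h' : ((k + m - 1).choose k : ℂ) ≠ 0 := by exact_mod_cast h
  rw [ContinuousLinearMap.adjoint_inner_left, Bergman.monomial_inner, hO, hO, inner_smul_left,
    inner_smul_left, inner_smul_right, ContinuousLinearMap.adjoint_inner_left,
    ContinuousLinearMap.adjoint_inner_left, bergmanWeight]
  push_cast
  field_simp

theorem isObservabilityGramian_zero : IsObservabilityGramian C A 0 (C.adjoint ∘L C) := by
  intro x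
  have h := hasSum_single (f := fun k : ℕ => ((k + 0 - 1).choose k : ℂ) •
    ((A ^ k).adjoint (C.adjoint (C ((A ^ k) x))))) 0 fun k hk => by
      rw [Nat.choose_eq_zero_of_lt (by omega), Nat.cast_zero, zero_smul]
  convert h using 1
  rw [pow_zero, ContinuousLinearMap.one_def, ContinuousLinearMap.adjoint_id]
  simp

/-- The power series of `C (I - zA)⁻ᵐ x`. -/
theorem IsNormalizedPair.hasSum_resolvent (h : IsNormalizedPair n C A) (hA : ‖A‖ ≤ 1)
    (hmn : m ≤ n) {z : ℂ} (hz : ‖z‖ < 1) (x : X) :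
    HasSum (fun k => (k + m - 1).choose k • (z ^ k • C ((A ^ k) x)))
      (C ((Ring.inverse (1 - z • A) ^ m) x)) := by
  induction m generalizing x with
  | zero =>
    have h := hasSum_single (f := fun k : ℕ => (k + 0 - 1).choose k • (z ^ k • C ((A ^ k) x))) 0
      fun k hk => by rw [Nat.choose_eq_zero_of_lt (by omega), zero_smul]
    simpa using h
  | succ m ih =>
    obtain ⟨O, hO⟩ := h.exists_isObservabilityOperator hmn
    have hO' := hO.hasSum_eval ⟨z, mem_ball_zero_iff.2 hz⟩
    -- Let `f_m(x)` be the sum of the series of order `m`. Pascal's rule gives `f_{m+1}(y) - z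
    -- f_{m+1}(A y) = f_m(y)`, and the left side is `f_{m+1}(x)` since `x = y - z A y`.
    set y := Ring.inverse (1 - z • A) x with hy
    have hxy : y - z • A y = x := by
      have h1 := Ring.mul_inverse_cancel _ (isUnit_one_sub_smul_of_contraction hA hz)
      exact congrArg (fun T => T x) h1
    have ht := (hO' (A y)).const_smul z
    have h1 := HasSum.choose_nsmul_sub (a := fun k => z ^ k • C ((A ^ k) y)) (hO' y)
      (ht.congr_fun fun k => by
        rw [smul_comm z, smul_smul, ← pow_succ', pow_succ A]
        rfl)
    have h2 := h1.unique (ih (by omega) y)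
    rw [← map_smul, ← map_smul, ← map_sub, ← map_sub, hxy] at h2
    rw [pow_succ, mul_apply_eq_comp, ← hy, ← h2]
    exact hO' x

end Observability

/-! ### Iterated completions and the telescoping kernel identity -/

section Iteration

variable {X Y : Type u}
  [NormedAddCommGroup X] [InnerProductSpace ℂ X] [CompleteSpace X]
  [NormedAddCommGroup Y] [InnerProductSpace ℂ Y] [CompleteSpace Y]
  {C : X →L[ℂ] Y} {A : X →L[ℂ] X}

/-- The form `⟪N_m(z)^* y, N_m(w)^* y'⟫`, where `N_0 = I_Y`. -/
def iterationKernel (N : ℕ → ℂ → X →L[ℂ] Y) (m : ℕ) (z w : ℂ) (y y' : Y) : ℂ :=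
  if m = 0 then ⟪y, y'⟫_ℂ else ⟪(N m z).adjoint y, (N m w).adjoint y'⟫_ℂ

/-- One step of the iterated unitary completion, from the gramian of order `m` to that of order
`m + 1`. -/
theorem exists_iteration_step (hA : ‖A‖ ≤ 1) {G : ℕ → X →L[ℂ] X} {N : ℕ → ℂ → X →L[ℂ] Y} {m : ℕ}
    (hdense : DenseRange (CFC.sqrt (G (m + 1)) : X →L[ℂ] X))
    (hnorm : ∀ x, ‖CFC.sqrt (G (m + 1)) x‖ ^ 2 =
      ‖CFC.sqrt (G (m + 1)) (A x)‖ ^ 2 + ‖CFC.sqrt (G m) x‖ ^ 2)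
    (h0 : m = 0 → ∀ x, ‖CFC.sqrt (G 0) x‖ = ‖C x‖)
    (hdiff : m ≠ 0 → DifferentiableOn ℂ (N m) (Metric.ball 0 1))
    (hN : m ≠ 0 → ∀ z : ℂ, ‖z‖ < 1 →
      N m z ∘L CFC.sqrt (G m) = C ∘L Ring.inverse (1 - z • A) ^ m)
    (hN' : ∀ z : ℂ, ‖z‖ < 1 →
      N (m + 1) z ∘L CFC.sqrt (G (m + 1)) = C ∘L Ring.inverse (1 - z • A) ^ (m + 1)) :
    ∃ (U : Type u) (_ : NormedAddCommGroup U) (_ : InnerProductSpace ℂ U) (_ : CompleteSpace U)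
      (F : ℂ → U →L[ℂ] Y), DifferentiableOn ℂ F (Metric.ball 0 1) ∧
      (m = 0 → IsUnitaryCompletion A (CFC.sqrt (G 1)) C F) ∧
      (m ≠ 0 → ∃ Ψ : ℂ → U →L[ℂ] X,
        IsUnitaryCompletion A (CFC.sqrt (G (m + 1))) (CFC.sqrt (G m)) Ψ ∧
        ∀ z : ℂ, ‖z‖ < 1 → F z = N m z ∘L Ψ z) ∧
      ∀ z w : ℂ, ‖z‖ < 1 → ‖w‖ < 1 → ∀ y y' : Y,
        iterationKernel N m z w y y' - ⟪(F z).adjoint y, (F w).adjoint y'⟫_ℂ =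
          (1 - z * conj w) * iterationKernel N (m + 1) z w y y' := by
  -- At order zero the completion uses `C` itself, with values in `Y`, rather than `G_0^{1/2}` with
  -- values in `X`; the two have equal norms, and the left factor is the identity of `Y`.
  rcases eq_or_ne m 0 with rfl | hm
  · obtain ⟨U, i1, i2, i3, Ψ, h1, h2, h3⟩ := exists_isUnitaryCompletion (Q := C)
      (N₀ := fun _ => ContinuousLinearMap.id ℂ Y) (N₁ := N (0 + 1)) hA hdense
      (fun x => by rw [hnorm, h0 rfl]) (fun z hz => by
        rw [hN' z hz, zero_add, pow_one, ContinuousLinearMap.id_comp])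
    refine ⟨U, i1, i2, i3, Ψ, h2, fun _ => h1, fun h => absurd rfl h, fun z w hz hw y y' => ?_⟩
    simpa [iterationKernel, ContinuousLinearMap.adjoint_id] using h3 z w hz hw y y'
  · obtain ⟨U, i1, i2, i3, Ψ, h1, h2, h3⟩ := exists_isUnitaryCompletion (Q := CFC.sqrt (G m))
      (N₀ := N m) (N₁ := N (m + 1)) hA hdense hnorm (fun z hz => by
        rw [hN' z hz, ← ContinuousLinearMap.comp_assoc, hN hm z hz, pow_succ]
        rfl)
    refine ⟨U, i1, i2, i3, fun z => N m z ∘L Ψ z, (hdiff hm).clm_comp h2, fun h => absurd h hm,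
      fun _ => ⟨Ψ, h1, fun _ _ => rfl⟩, fun z w hz hw y y' => ?_⟩
    rw [iterationKernel, iterationKernel, if_neg hm, if_neg (Nat.succ_ne_zero m)]
    exact h3 z w hz hw y y'

/-- Telescoping of `k_m - p = d k_{m+1}`, indexed backwards. -/
theorem sum_inv_pow_mul_of_sub_eq {n : ℕ} {d : ℂ} (hd : d ≠ 0) {k : ℕ → ℂ} {p : Fin n → ℂ}
    (h : ∀ i : Fin n, k (n - ((i : ℕ) + 1)) - p i = d * k (n - (i : ℕ))) :
    ∑ i : Fin n, (d ^ ((i : ℕ) + 1))⁻¹ * p i = (d ^ n)⁻¹ * k 0 - k n := by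
  -- Each term is a difference of consecutive values of `d⁻ⁱ k (n - i)`.
  have hterm : ∀ i : Fin n, (d ^ ((i : ℕ) + 1))⁻¹ * p i =
      (d ^ ((i : ℕ) + 1))⁻¹ * k (n - ((i : ℕ) + 1)) - (d ^ (i : ℕ))⁻¹ * k (n - (i : ℕ)) := fun i => by
    have h1 : p i = k (n - ((i : ℕ) + 1)) - d * k (n - (i : ℕ)) := by rw [← h i]; ring
    rw [h1, pow_succ]
    field_simp
  rw [Finset.sum_congr rfl fun i _ => hterm i, Fin.sum_univ_eq_sum_range
    (fun i => (d ^ (i + 1))⁻¹ * k (n - (i + 1)) - (d ^ i)⁻¹ * k (n - i)) n,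
    Finset.sum_range_sub (fun i => (d ^ i)⁻¹ * k (n - i))]
  simp

/-- A normalized output pair has an iterated realization; the resulting functions satisfy the
kernel identity
`∑ F_j(z) F_j(w)^* / (1 - z w̄)^j = I / (1 - z w̄)^n - C (I - zA)⁻ⁿ (I - w̄ A^*)⁻ⁿ C^*`. -/
theorem IsNormalizedPair.exists_hasIteratedRealization {n : ℕ} [NeZero n]
    (h : IsNormalizedPair n C A) (hA : ‖A‖ ≤ 1) :
    ∃ (U : Fin n → Type u) (_ : ∀ j, NormedAddCommGroup (U j))
      (_ : ∀ j, InnerProductSpace ℂ (U j)) (_ : ∀ j, CompleteSpace (U j))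
      (F : ∀ j, ℂ → U j →L[ℂ] Y),
      (∀ j, DifferentiableOn ℂ (F j) (Metric.ball 0 1)) ∧
      HasIteratedRealization C A F ∧
      ∀ z w : ℂ, ‖z‖ < 1 → ‖w‖ < 1 → ∀ y y' : Y,
        ∑ j : Fin n, ((1 - z * conj w) ^ ((j : ℕ) + 1))⁻¹ *
            ⟪(F j z).adjoint y, (F j w).adjoint y'⟫_ℂ =
          ((1 - z * conj w) ^ n)⁻¹ * ⟪y, y'⟫_ℂ -
            ⟪(C ∘L Ring.inverse (1 - z • A) ^ n).adjoint y,
              (C ∘L Ring.inverse (1 - w • A) ^ n).adjoint y'⟫_ℂ := by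
  -- The condition `m ≤ n` sits inside the existential so that `choose` yields sequences indexed by
  -- all of `ℕ`. The orders are treated separately, so the last clause refers to order `m - 1`
  -- through its series; this is later identified with `‖G_{m-1}^{1/2} x‖²`.
  have key : ∀ m : ℕ, ∃ (G : X →L[ℂ] X) (N : ℂ → X →L[ℂ] Y), m ≤ n →
      IsObservabilityGramian C A m G ∧
      (∀ x, HasSum (fun k => (k + m - 1).choose k • ‖C ((A ^ k) x)‖ ^ 2) (‖CFC.sqrt G x‖ ^ 2)) ∧
      (m ≠ 0 → DenseRange (CFC.sqrt G : X →L[ℂ] X) ∧ DifferentiableOn ℂ N (Metric.ball 0 1) ∧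
        (∀ z : ℂ, ‖z‖ < 1 → N z ∘L CFC.sqrt G = C ∘L Ring.inverse (1 - z • A) ^ m) ∧
        ∀ x, ‖CFC.sqrt G x‖ ^ 2 = ‖CFC.sqrt G (A x)‖ ^ 2 +
          ∑' k, (k + (m - 1) - 1).choose k • ‖C ((A ^ k) x)‖ ^ 2) := by
    intro m
    by_cases hmn : m ≤ n
    swap
    · exact ⟨0, 0, fun h => absurd h hmn⟩
    rcases m with _ | m
    · refine ⟨C.adjoint ∘L C, 0, fun _ => ⟨isObservabilityGramian_zero, fun x => ?_,
        fun h => absurd rfl h⟩⟩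
      rw [norm_sqrt_adjoint_comp_apply]
      have h := hasSum_single (f := fun k : ℕ => (k + 0 - 1).choose k • ‖C ((A ^ k) x)‖ ^ 2) 0
        fun k hk => by rw [Nat.choose_eq_zero_of_lt (by omega), zero_smul]
      simpa using h
    · obtain ⟨O, hO⟩ := h.exists_isObservabilityOperator hmn
      have hdense := denseRange_sqrt_adjoint_comp fun x => h.eq_zero hO (x := x)
      -- The isometric factor in the polar decomposition `O = V G^{1/2}`. Evaluating `V` at `z`
      -- defines `N z` without inverting `G^{1/2}`, and gives its holomorphy.
      obtain ⟨V, hV⟩ := exists_linearIsometry_of_norm_eq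
        (CFC.sqrt (O.adjoint ∘L O) : X →L[ℂ] X).toLinearMap O.toLinearMap hdense
        fun x => (norm_sqrt_adjoint_comp_apply O x).symm
      obtain ⟨N, hN, hN'⟩ := Bergman.exists_differentiableOn_eval_comp V.toContinuousLinearMap
        fun x => (V.norm_map x).le
      refine ⟨O.adjoint ∘L O, N, fun _ => ⟨hO.isObservabilityGramian, fun x => ?_,
        fun _ => ⟨hdense, hN, fun z hz => ?_, fun x => ?_⟩⟩⟩
      · rw [norm_sqrt_adjoint_comp_apply]
        exact hO.hasSum_norm_sq x
      · ext x
        refine (hN' ⟨z, mem_ball_zero_iff.2 hz⟩ _).trans ?_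
        refine Eq.trans (congrArg _ (hV x)) ?_
        exact (hO.hasSum_eval ⟨z, mem_ball_zero_iff.2 hz⟩ x).unique
          (h.hasSum_resolvent hA hmn hz x)
      · rw [norm_sqrt_adjoint_comp_apply, norm_sqrt_adjoint_comp_apply]
        rw [Nat.add_sub_cancel]
        refine hO.norm_sq_succ (Summable.hasSum ?_)
        refine Summable.of_nonneg_of_le (fun k => by positivity)
          (fun k => nsmul_le_nsmul_left (sq_nonneg _) (Nat.choose_le_choose k ?_)) (h x).summable
        omega
  choose G N hGN using key
  have step : ∀ i : Fin n, ∃ (U : Type u) (_ : NormedAddCommGroup U) (_ : InnerProductSpace ℂ U)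
      (_ : CompleteSpace U) (F : ℂ → U →L[ℂ] Y), DifferentiableOn ℂ F (Metric.ball 0 1) ∧
      ((i : ℕ) + 1 = n → IsUnitaryCompletion A (CFC.sqrt (G 1)) C F) ∧
      ((i : ℕ) + 1 < n → ∃ Ψ : ℂ → U →L[ℂ] X,
        IsUnitaryCompletion A (CFC.sqrt (G (n - (i : ℕ)))) (CFC.sqrt (G (n - ((i : ℕ) + 1)))) Ψ ∧
        ∀ z : ℂ, ‖z‖ < 1 → F z = N (n - ((i : ℕ) + 1)) z ∘L Ψ z) ∧
      ∀ z w : ℂ, ‖z‖ < 1 → ‖w‖ < 1 → ∀ y y' : Y,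
        iterationKernel N (n - ((i : ℕ) + 1)) z w y y' - ⟪(F z).adjoint y, (F w).adjoint y'⟫_ℂ =
          (1 - z * conj w) * iterationKernel N (n - (i : ℕ)) z w y y' := by
    intro i
    -- The Bergman index `i + 1` and the gramian order `m` add up to `n`; the step goes from order
    -- `m` to `m + 1`.
    obtain ⟨m, hm⟩ : ∃ m, n - ((i : ℕ) + 1) = m := ⟨_, rfl⟩
    have hi := i.2
    have hm' : n - (i : ℕ) = m + 1 := by omega
    rw [hm, hm']
    obtain ⟨-, hs, hd⟩ := hGN m (by omega)
    obtain ⟨-, -, hd'⟩ := hGN (m + 1) (by omega)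
    obtain ⟨hd1, -, hd3, hd4⟩ := hd' (Nat.succ_ne_zero m)
    obtain ⟨U, i1, i2, i3, F, h1, h2, h3, h4⟩ := exists_iteration_step (C := C) hA (N := N) hd1
      (fun x => by rw [hd4, ← (hs x).tsum_eq]; rfl)
      (fun h0 x => by
        subst h0
        have h5 := hasSum_single (f := fun k : ℕ => (k + 0 - 1).choose k • ‖C ((A ^ k) x)‖ ^ 2) 0
          fun k hk => by rw [Nat.choose_eq_zero_of_lt (by omega), zero_smul]
        have h6 := (hs x).unique h5
        refine (sq_eq_sq₀ (norm_nonneg _) (norm_nonneg _)).1 ?_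
        simpa using h6)
      (fun h0 => (hd h0).2.1) (fun h0 => (hd h0).2.2.1) hd3
    exact ⟨U, i1, i2, i3, F, h1, fun h5 => h2 (by omega), fun h5 => h3 (by omega), h4⟩
  choose U i1 i2 i3 F h1 h2 h3 h4 using step
  refine ⟨U, i1, i2, i3, F, h1, ⟨G, fun m hm => (hGN m hm).1, h2, fun i hi => ?_⟩, ?_⟩
  · obtain ⟨Ψ, hΨ, hΨ'⟩ := h3 i hi
    have hN := ((hGN (n - ((i : ℕ) + 1)) (by omega)).2.2 (by omega)).2.2.1
    exact ⟨Ψ, hΨ, N (n - ((i : ℕ) + 1)), fun z hz => ⟨hN z hz, hΨ' z hz⟩⟩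
  · intro z w hz hw y y'
    have hd : 1 - z * conj w ≠ 0 := by
      refine sub_ne_zero.2 fun h => ?_
      have h5 := congrArg norm h
      rw [norm_one, norm_mul, RCLike.norm_conj] at h5
      nlinarith [norm_nonneg z, norm_nonneg w]
    have hn := NeZero.ne n
    rw [sum_inv_pow_mul_of_sub_eq (k := fun m => iterationKernel N m z w y y') hd
      fun i => h4 i z w hz hw y y', iterationKernel,
      iterationKernel, if_pos rfl, if_neg hn]
    obtain ⟨-, hs, hd⟩ := hGN n le_rfl
    obtain ⟨-, -, hd3, -⟩ := hd hn
    -- The normalization makes `G_n^{1/2}` an isometry, so the kernel of `N_n` agrees with that of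
    -- `C (I - zA)⁻ⁿ`.
    have hiso : ∀ x, ‖CFC.sqrt (G n) x‖ = ‖x‖ := fun x =>
      (sq_eq_sq₀ (norm_nonneg _) (norm_nonneg _)).1 ((hs x).unique (h x))
    let R : X →ₗᵢ[ℂ] X := ⟨(CFC.sqrt (G n) : X →L[ℂ] X).toLinearMap, hiso⟩
    have hadj : ∀ z : ℂ, ‖z‖ < 1 → ∀ y,
        (C ∘L Ring.inverse (1 - z • A) ^ n).adjoint y = R ((N n z).adjoint y) := fun z hz y => by
      rw [← hd3 z hz, ContinuousLinearMap.adjoint_comp, (isSelfAdjoint_sqrt _).adjoint_eq]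
      rfl
    rw [hadj z hz, hadj w hw, R.inner_map_map]

end Iteration

/-! ### Isometries from equal Gram matrices -/

section GramEquality

/-- Two families with the same Gram matrix, the first one total, are intertwined by a linear
isometry. -/
theorem exists_linearIsometry_of_inner_eq {I H K : Type*}
    [NormedAddCommGroup H] [InnerProductSpace ℂ H] [CompleteSpace H]
    [NormedAddCommGroup K] [InnerProductSpace ℂ K] [CompleteSpace K] (a : I → H) (b : I → K)
    (htotal : ∀ f, (∀ i, ⟪a i, f⟫_ℂ = 0) → f = 0) (hab : ∀ i j, ⟪b i, b j⟫_ℂ = ⟪a i, a j⟫_ℂ) :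
    ∃ V : H →ₗᵢ[ℂ] K, ∀ i, V (a i) = b i := by
  have hdense : DenseRange (Finsupp.linearCombination ℂ a) := by
    have h : (LinearMap.range (Finsupp.linearCombination ℂ a)).topologicalClosure = ⊤ := by
      rw [Submodule.topologicalClosure_eq_top_iff, Submodule.eq_bot_iff]
      intro f hf
      refine htotal f fun i => (Submodule.mem_orthogonal _ f).1 hf _ ⟨Finsupp.single i 1, ?_⟩
      simp
    exact Submodule.dense_iff_topologicalClosure_eq_top.2 h
  obtain ⟨V, hV⟩ := exists_linearIsometry_of_norm_eq (Finsupp.linearCombination ℂ a)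
    (Finsupp.linearCombination ℂ b) hdense fun x => by
      refine (sq_eq_sq₀ (norm_nonneg _) (norm_nonneg _)).1 ?_
      rw [← inner_self_eq_norm_sq (𝕜 := ℂ), ← inner_self_eq_norm_sq (𝕜 := ℂ)]
      simp only [Finsupp.linearCombination_apply, Finsupp.sum, sum_inner, inner_sum,
        inner_smul_left, inner_smul_right, hab]
  exact ⟨V, fun i => by simpa using hV (Finsupp.single i 1)⟩

end GramEquality

/-! ### From the kernel identity to the multiplication operator -/

section Multiplication

variable {n : ℕ} [NeZero n] {Y : Type u} [NormedAddCommGroup Y] [InnerProductSpace ℂ Y]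
  [CompleteSpace Y]

/-- If `∑ F_j(z) F_j(ζ)^* / (1 - z ζ̄)^j` is the reproducing kernel of the closed subspace `M`, then
multiplication by `F` is a partial isometry onto `M`. -/
theorem exists_isMultiplicationOperator {M : Submodule ℂ (Bergman n Y)}
    (hclosed : IsClosed (M : Set (Bergman n Y))) {U : Fin n → Type u}
    [∀ j, NormedAddCommGroup (U j)] [∀ j, InnerProductSpace ℂ (U j)] [∀ j, CompleteSpace (U j)]
    {F : ∀ j, ℂ → U j →L[ℂ] Y}
    (hF : IsReproducingKernelOf M (fun z ζ : Metric.ball (0 : ℂ) 1 => ∑ j : Fin n,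
      ((1 - (z : ℂ) * conj (ζ : ℂ)) ^ ((j : ℕ) + 1))⁻¹ • (F j z ∘L (F j ζ).adjoint))) :
    ∃ T : PiLp 2 (fun j : Fin n => Bergman ((j : ℕ) + 1) (U j)) →L[ℂ] Bergman n Y,
      IsMultiplicationOperator F T ∧ IsPartialIsometry T ∧
      Set.range T = (M : Set (Bergman n Y)) := by
  have : CompleteSpace M := hclosed.completeSpace_coe
  choose g hgM hgz hgf using hF
  let a : Metric.ball (0 : ℂ) 1 × Y → M := fun p => ⟨g p.1 p.2, hgM p.1 p.2⟩
  -- These vectors are what `M_F^*` must assign to the kernel functions `a` of `M`. The kernel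
  -- formula says that both families have the same Gram matrix.
  let b : Metric.ball (0 : ℂ) 1 × Y → PiLp 2 (fun j : Fin n => Bergman ((j : ℕ) + 1) (U j)) :=
    fun p => WithLp.toLp 2 fun j =>
      RKHS.kerFun (Bergman ((j : ℕ) + 1) (U j)) p.1 ((F j p.1).adjoint p.2)
  have hb : ∀ p h, ⟪b p, h⟫_ℂ = ⟪p.2, ∑ j, F j p.1 (h j p.1)⟫_ℂ := fun p h => by
    rw [PiLp.inner_apply, inner_sum]
    refine Finset.sum_congr rfl fun j _ => ?_
    rw [← ContinuousLinearMap.adjoint_inner_left]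
    exact RKHS.kerFun_inner _ _ _
  obtain ⟨J, hJ⟩ := exists_linearIsometry_of_inner_eq a b
    (fun f hf => by
      refine Subtype.ext (RKHS.ext fun z => ?_)
      refine ext_inner_left ℂ fun y => ?_
      rw [← hgf z y f f.2]
      refine (hf (z, y)).trans ?_
      simp)
    (fun p q => by
      rw [hb]
      refine Eq.trans ?_ (hgf p.1 p.2 _ (hgM q.1 q.2)).symm
      rw [hgz]
      congr 1
      rw [sum_apply]
      refine Finset.sum_congr rfl fun j _ => ?_
      change F j p.1 (RKHS.kerFun (Bergman ((j : ℕ) + 1) (U j)) q.1 ((F j q.1).adjoint q.2) p.1) = _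
      rw [RKHS.kerFun_apply, Bergman.kernel_eq]
      simp)
  let J' := J.toContinuousLinearMap
  have hJJ : ∀ v, J'.adjoint (J v) = v := fun v => by
    refine ext_inner_left ℂ fun w => ?_
    rw [ContinuousLinearMap.adjoint_inner_right]
    exact J.inner_map_map w v
  have hT : ∀ h, (M.subtypeL ∘L J'.adjoint) h = (J'.adjoint h : Bergman n Y) := fun h => rfl
  refine ⟨M.subtypeL ∘L J'.adjoint, fun h z => ?_, fun x hx => ?_, ?_⟩
  · refine ext_inner_left ℂ fun y => ?_
    rw [hT, ← hgf z y _ (J'.adjoint h).2, ← hb (z, y) h, ← hJ]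
    exact ContinuousLinearMap.adjoint_inner_right J' (a (z, y)) h
  -- `J J^* x` is the projection of `x` to the range of `J`, and the difference lies in the kernel.
  -- It is orthogonal both to `x` and to `J J^* x`, hence zero.
  · have h1 : x - J (J'.adjoint x) ∈ LinearMap.ker (M.subtypeL ∘L J'.adjoint).toLinearMap := by
      rw [LinearMap.mem_ker]
      change ((J'.adjoint (x - J (J'.adjoint x)) : M) : Bergman n Y) = 0
      rw [map_sub, hJJ, sub_self]
      rfl
    have h2 : ⟪x - J (J'.adjoint x), x⟫_ℂ = 0 := (Submodule.mem_orthogonal _ _).1 hx _ h1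
    have h3 : ⟪x - J (J'.adjoint x), J (J'.adjoint x)⟫_ℂ = 0 := by
      have h4 : ⟪J'.adjoint (x - J (J'.adjoint x)), J'.adjoint x⟫_ℂ = 0 := by
        rw [map_sub, hJJ, sub_self, inner_zero_left]
      rwa [ContinuousLinearMap.adjoint_inner_left] at h4
    have h5 : x - J (J'.adjoint x) = 0 := by
      rw [← inner_self_eq_zero (𝕜 := ℂ), inner_sub_right, h2, h3, sub_zero]
    rw [hT]
    exact (J.norm_map _).symm.trans (congrArg norm (sub_eq_zero.1 h5).symm)
  · ext f
    refine ⟨?_, fun hf => ⟨J ⟨f, hf⟩, ?_⟩⟩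
    · rintro ⟨h, rfl⟩
      exact (J'.adjoint h).2
    · rw [hT, hJJ]

end Multiplication

/-! ### The model pair on the orthogonal complement of `M` -/

section Model

variable {n : ℕ} [NeZero n] {Y : Type u} [NormedAddCommGroup Y] [InnerProductSpace ℂ Y]
  [CompleteSpace Y]

namespace Bergman

/-- Pair both sides with `y z^j`: the shift turns it into `y z^{j+1}`, and weights enter through the
inner product. -/
theorem weight_smul_coeff_adjoint_shift (f : Bergman n Y) (j : ℕ) :
    (bergmanWeight n j : ℂ) • ((shift n Y).adjoint f).coeff j =
      (bergmanWeight n (j + 1) : ℂ) • f.coeff (j + 1) := by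
  refine ext_inner_left ℂ fun y => ?_
  rw [inner_smul_right, inner_smul_right, ← monomial_inner, ← monomial_inner,
    ContinuousLinearMap.adjoint_inner_right, shift_monomial]

theorem weight_smul_coeff_adjoint_shift_pow (k : ℕ) (f : Bergman n Y) (j : ℕ) :
    (bergmanWeight n j : ℂ) • (((shift n Y).adjoint ^ k) f).coeff j =
      (bergmanWeight n (j + k) : ℂ) • f.coeff (j + k) := by
  induction k generalizing j with
  | zero => simp
  | succ k ih =>
    rw [pow_succ', mul_apply_eq_comp, weight_smul_coeff_adjoint_shift, ih,
      add_right_comm, add_assoc]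

theorem eval_zero_apply (f : Bergman n Y) :
    eval ⟨0, Metric.mem_ball_self one_pos⟩ f = f.coeff 0 := by
  rw [eval_apply, tsum_eq_single 0 fun j hj => by simp [hj]]
  simp

end Bergman

variable {M : Submodule ℂ (Bergman n Y)}

theorem modelOutput_modelState_pow (hM : ∀ f ∈ M, Bergman.shift n Y f ∈ M) (k : ℕ) (x : Mᗮ) :
    modelOutput M ((modelState M hM ^ k) x) =
      (bergmanWeight n k : ℂ) • (x : Bergman n Y).coeff k := by
  have hpow : (((modelState M hM ^ k) x : Mᗮ) : Bergman n Y) =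
      ((Bergman.shift n Y).adjoint ^ k) x := by
    induction k with
    | zero => rfl
    | succ k ih =>
      rw [pow_succ', pow_succ', mul_apply_eq_comp, mul_apply_eq_comp, ← ih]
      rfl
  have h := Bergman.weight_smul_coeff_adjoint_shift_pow k (x : Bergman n Y) 0
  rw [bergmanWeight_zero, Complex.ofReal_one, one_smul, zero_add, ← hpow] at h
  rw [← h]
  exact Bergman.eval_zero_apply _

/-- The outputs carry a factor `μ_k`, squared in the norm; the binomial `μ_k⁻¹` cancels one of the
two, leaving the Bergman norm. -/
theorem isNormalizedPair_model (hM : ∀ f ∈ M, Bergman.shift n Y f ∈ M) :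
    IsNormalizedPair n (modelOutput M) (modelState M hM) := by
  intro x
  rw [Submodule.coe_norm, Bergman.norm_sq_eq]
  refine (Bergman.summable_coeff (x : Bergman n Y)).hasSum.congr_fun fun k => ?_
  have h := bergmanWeight_pos n k
  rw [modelOutput_modelState_pow, norm_smul, Complex.norm_real, Real.norm_of_nonneg h.le]
  rw [bergmanWeight, inv_pos] at h
  rw [bergmanWeight, nsmul_eq_mul]
  field_simp

theorem norm_modelState_le (hM : ∀ f ∈ M, Bergman.shift n Y f ∈ M) : ‖modelState M hM‖ ≤ 1 := by
  refine ContinuousLinearMap.opNorm_le_bound _ zero_le_one fun x => ?_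
  have h : ‖(Bergman.shift n Y).adjoint‖ ≤ 1 := by
    rw [LinearIsometryEquiv.norm_map]
    exact LinearMap.mkContinuous_norm_le _ zero_le_one _
  exact (Bergman.shift n Y).adjoint.le_of_opNorm_le h x

/-- In the resolvent series of order `n` the binomials cancel the weights of the outputs, leaving
the Taylor series. This identifies the subtracted term of the kernel identity as the kernel of `Mᗮ`.
-/
theorem modelOutput_comp_resolvent_pow (hM : ∀ f ∈ M, Bergman.shift n Y f ∈ M)
    (z : Metric.ball (0 : ℂ) 1) :
    modelOutput M ∘L Ring.inverse (1 - (z : ℂ) • modelState M hM) ^ n =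
      Bergman.eval z ∘L Mᗮ.subtypeL := by
  have hz : ‖(z : ℂ)‖ < 1 := mem_ball_zero_iff.1 z.2
  ext x
  refine ((isNormalizedPair_model hM).hasSum_resolvent (norm_modelState_le hM) le_rfl hz x).unique
    ((Bergman.hasSum_pow_smul_coeff hz (x : Bergman n Y)).congr_fun fun k => ?_)
  have h := (bergmanWeight_pos n k).ne'
  rw [bergmanWeight, ne_eq, inv_eq_zero] at h
  have h' : ((k + n - 1).choose k : ℂ) ≠ 0 := by exact_mod_cast h
  rw [modelOutput_modelState_pow, ← Nat.cast_smul_eq_nsmul ℂ, smul_comm ((z : ℂ) ^ k), smul_smul,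
    bergmanWeight]
  push_cast
  rw [mul_inv_cancel₀ h', one_smul]

/-- The reproducing kernel of a closed subspace `M` is the kernel of `𝒜_n(Y)` minus that of
`Mᗮ`. -/
theorem isReproducingKernelOf_of_inner_eq (hclosed : IsClosed (M : Set (Bergman n Y)))
    {k : Metric.ball (0 : ℂ) 1 → Metric.ball (0 : ℂ) 1 → Y →L[ℂ] Y}
    (hk : ∀ z ζ y y', ⟪y, k z ζ y'⟫_ℂ =
      ((1 - (z : ℂ) * conj (ζ : ℂ)) ^ n)⁻¹ * ⟪y, y'⟫_ℂ -
        ⟪(Bergman.eval z ∘L Mᗮ.subtypeL).adjoint y,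
          (Bergman.eval ζ ∘L Mᗮ.subtypeL).adjoint y'⟫_ℂ) :
    IsReproducingKernelOf M k := by
  have : CompleteSpace M := hclosed.completeSpace_coe
  intro ζ y'
  -- The kernel function of `Mᗮ`, that is, the projection to `Mᗮ` of the kernel function of
  -- `𝒜_n(Y)`; the remainder lies in `Mᗮᗮ`, which is `M` by closedness.
  let v : Mᗮ := (Bergman.eval ζ ∘L Mᗮ.subtypeL).adjoint y'
  refine ⟨RKHS.kerFun (Bergman n Y) ζ y' - (v : Bergman n Y), ?_, fun z => ?_, fun f hf => ?_⟩
  · refine (Submodule.orthogonal_orthogonal M).le ((Submodule.mem_orthogonal _ _).2 ?_)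
    intro x hx
    have h1 : ⟪x, (v : Bergman n Y)⟫_ℂ = ⟪x ζ, y'⟫_ℂ :=
      ContinuousLinearMap.adjoint_inner_right (Bergman.eval ζ ∘L Mᗮ.subtypeL) ⟨x, hx⟩ y'
    rw [inner_sub_right, RKHS.inner_kerFun, h1, sub_self]
  · refine ext_inner_left ℂ fun y => ?_
    have h1 : ⟪(Bergman.eval z ∘L Mᗮ.subtypeL).adjoint y, v⟫_ℂ = ⟪y, (v : Bergman n Y) z⟫_ℂ :=
      ContinuousLinearMap.adjoint_inner_left (Bergman.eval z ∘L Mᗮ.subtypeL) v y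
    rw [hk, h1, RKHS.coe_sub, Pi.sub_apply, inner_sub_right, RKHS.kerFun_apply, Bergman.kernel_eq,
      FunLike.coe_smul, Pi.smul_apply, ContinuousLinearMap.id_apply, inner_smul_right]
  · rw [inner_sub_left, RKHS.kerFun_inner, Submodule.inner_left_of_mem_orthogonal hf v.2, sub_zero]

end Model

end

/-! ### The representation theorem -/

theorem theorem6p1 (n : ℕ) [NeZero n] (Y : Type u) [NormedAddCommGroup Y] [InnerProductSpace ℂ Y]
    [CompleteSpace Y] (M : Submodule ℂ (Bergman n Y)) (hclosed : IsClosed (M : Set (Bergman n Y)))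
    (hM : ∀ f ∈ M, Bergman.shift n Y f ∈ M) :
    ∃ (U : Fin n → Type u) (_ : ∀ j, NormedAddCommGroup (U j))
      (_ : ∀ j, InnerProductSpace ℂ (U j)) (_ : ∀ j, CompleteSpace (U j))
      (F : ∀ j, ℂ → U j →L[ℂ] Y)
      (T : PiLp 2 (fun j : Fin n => Bergman ((j : ℕ) + 1) (U j)) →L[ℂ] Bergman n Y),
      (∀ j, DifferentiableOn ℂ (F j) (Metric.ball 0 1)) ∧
      IsMultiplicationOperator F T ∧
      IsPartialIsometry T ∧
      Set.range T = (M : Set (Bergman n Y)) ∧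
      IsReproducingKernelOf M (fun z ζ : Metric.ball (0 : ℂ) 1 => ∑ j : Fin n,
        ((1 - (z : ℂ) * conj (ζ : ℂ)) ^ ((j : ℕ) + 1))⁻¹ • (F j z ∘L (F j ζ).adjoint)) ∧
      HasIteratedRealization (modelOutput M) (modelState M hM) F := by
  obtain ⟨U, i1, i2, i3, F, hF, hreal, hker⟩ :=
    (isNormalizedPair_model hM).exists_hasIteratedRealization (norm_modelState_le hM)
  have hk : IsReproducingKernelOf M (fun z ζ : Metric.ball (0 : ℂ) 1 => ∑ j : Fin n,
      ((1 - (z : ℂ) * conj (ζ : ℂ)) ^ ((j : ℕ) + 1))⁻¹ • (F j z ∘L (F j ζ).adjoint)) := by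
    refine isReproducingKernelOf_of_inner_eq hclosed fun z ζ y y' => ?_
    rw [← modelOutput_comp_resolvent_pow hM z, ← modelOutput_comp_resolvent_pow hM ζ,
      ← hker z ζ (mem_ball_zero_iff.1 z.2) (mem_ball_zero_iff.1 ζ.2), sum_apply,
      inner_sum]
    refine Finset.sum_congr rfl fun j _ => ?_
    rw [FunLike.coe_smul, Pi.smul_apply, inner_smul_right, ContinuousLinearMap.comp_apply,
      ContinuousLinearMap.adjoint_inner_left]
  obtain ⟨T, hT, hT', hT''⟩ := exists_isMultiplicationOperator hclosed hk
  exact ⟨U, i1, i2, i3, F, T, hF, hT, hT', hT'', hk, hreal⟩
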